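/- A triangulation is a finite simple connected graph combinatorially embedded in the sphere (that is, given with the cyclic order of the edges around each vertex) in which every face, including the outer face, is bounded by a cycle of length $3$. If $xy$ is an edge of a triangulation and $xya$, $xyb$ are the two faces at $xy$, where $a \neq b$ and $ab$ is not an edge, then flipping $xy$ means deleting $xy$ and adding the edge $ab$ inside the resulting quadrilateral face $xbya$; the result is again a triangulation. A separating triangle is a cycle of length $3$ whose removal (of its three vertices) disconnects the graph. Theorem. Let $n \geq 6$. For every triangulation $T$ on $n$ vertices there is a sequence of at most $\lfloor (3n-6)/5 \rfloor$ edge flips that transforms $T$ into a triangulation that is $4$-connected; in particular, the resulting triangulation has no separating triangle. -/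

import Mathlib

/-- A combinatorial embedding of a simple graph on `V` in an oriented closed surface: `rot v` is the
cyclic order of the neighbours of `v`, i.e. it sends a neighbour of `v` to the next one around `v`.
By convention `rot v` fixes every vertex that is not a neighbour of `v`. -/
structure RotationSystem (V : Type*) where
  graph : SimpleGraph V
  rot : V → Equiv.Perm V
  rot_isCycleOn : ∀ v, (rot v).IsCycleOn (graph.neighborSet v)
  rot_eq_self : ∀ v w, ¬ graph.Adj v w → rot v w = w

namespace RotationSystem

variable {V : Type*}

theorem adj_rot (R : RotationSystem V) {v w : V} (h : R.graph.Adj v w) :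
    R.graph.Adj v (R.rot v w) :=
  (R.rot_isCycleOn v).1.mapsTo h

theorem adj_rot_symm (R : RotationSystem V) {v w : V} (h : R.graph.Adj v w) :
    R.graph.Adj v ((R.rot v).symm w) := by
  obtain ⟨u, hu, rfl⟩ := (R.rot_isCycleOn v).1.surjOn h
  simpa using hu

/-- Face tracing: having walked along the directed edge `(u, v)`, the boundary walk of the face
continues with the directed edge `(v, rot v u)`. -/
def facePerm (R : RotationSystem V) : Equiv.Perm R.graph.Dart where
  toFun d := ⟨(d.snd, R.rot d.snd d.fst), R.adj_rot d.adj.symm⟩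
  invFun d := ⟨((R.rot d.fst).symm d.snd, d.fst), (R.adj_rot_symm d.adj).symm⟩
  left_inv d := by ext <;> simp
  right_inv d := by ext <;> simp

/-- The faces of the embedding: the orbits of face tracing on the directed edges. -/
def Face (R : RotationSystem V) : Type _ :=
  Quotient (Equiv.Perm.SameCycle.setoid R.facePerm)

end RotationSystem

/-- A (combinatorial) triangulation with vertex set `V`: a connected simple graph together with a
combinatorial embedding in the sphere (genus zero, expressed by Euler's formula) all of whose faces,
the outer face included, are bounded by three edges. (As the graph is simple, such a boundary is a
cycle through three distinct vertices.) -/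
structure Triangulation (V : Type*) extends RotationSystem V where
  connected : graph.Connected
  euler : Nat.card V + Nat.card toRotationSystem.Face = Nat.card graph.edgeSet + 2
  face_length : ∀ d, Function.minimalPeriod toRotationSystem.facePerm d = 3

namespace Triangulation

variable {V : Type*} [DecidableEq V]

/-- `T.IsFlipAt x y T'`: the triangulation `T'` arises from `T` by flipping the edge `xy`.
Here `xya` and `yxb` are the two faces at `xy`; the edge `xy` is deleted and the edge `ab`, which
must not be present in `T`, is drawn inside the quadrilateral `xbya` left behind.
Around the vertices, in the order given by `rot`:
at `x`, `a, y, b` becomes `a, b`; at `y`, `b, x, a` becomes `b, a`;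
at `a`, `y, x` becomes `y, b, x`; at `b`, `x, y` becomes `x, a, y`. Nothing else changes. -/
def IsFlipAt (T : Triangulation V) (x y : V) (T' : Triangulation V) : Prop :=
  let a := T.rot y x
  let b := T.rot x y
  T.graph.Adj x y ∧ a ≠ b ∧ ¬ T.graph.Adj a b ∧
  T'.graph = T.graph.deleteEdges {s(x, y)} ⊔ SimpleGraph.edge a b ∧
  T'.rot x = T.rot x * Equiv.swap a y ∧
  T'.rot y = T.rot y * Equiv.swap b x ∧
  T'.rot a = T.rot a * Equiv.swap y b ∧
  T'.rot b = T.rot b * Equiv.swap x a ∧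
  ∀ v, v ≠ x → v ≠ y → v ≠ a → v ≠ b → T'.rot v = T.rot v

/-- `T'` arises from `T` by a single edge flip. -/
def IsFlip (T T' : Triangulation V) : Prop :=
  ∃ x y, T.IsFlipAt x y T'

end Triangulation

namespace SimpleGraph

variable {V : Type*}

/-- `G` is `k`-connected: it has more than `k` vertices, and removing fewer than `k` vertices always
leaves a connected graph. -/
def IsKVertexConnected (G : SimpleGraph V) (k : ℕ) : Prop :=
  (k : ℕ∞) < ENat.card V ∧
    ∀ S : Finset V, S.card < k → (G.induce {v | v ∉ S}).Connected

/-- A separating triangle: three pairwise adjacent vertices whose removal disconnects the graph. -/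
def IsSeparatingTriangle (G : SimpleGraph V) (D : Finset V) : Prop :=
  G.IsNClique 3 D ∧ ¬ (G.induce {v | v ∉ D}).Preconnected

end SimpleGraph

/-! In a triangulation the link of every vertex is a cycle, so a cut of at most three vertices must
be a separating triangle (`isKVertexConnected_four`). It remains to destroy all separating triangles
with few flips.

Flipping an edge of a separating triangle creates no new one if the edge lies in several separating
triangles, or if the triangle shares no edge with another (`exists_isFlip_of_isSeparatingTriangle`).

Fix a face as root, so that each separating triangle has an inside, the side away from the root. The
potential counts the edges in separating triangles together with the pairs of a vertex and an
innermost separating triangle through it. Each such pair can be charged to an edge running from the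
vertex into the triangle; these edges are distinct and lie in no separating triangle, so the
potential is at most the number `3n - 6` of edges (`nestingPotential_le`). A suitable flip at a most
deeply nested separating triangle lowers it by at least `5` (`exists_nestingPotential_add_five_le`).
This last step uses only the laws collected in `IsNesting`. -/

namespace SimpleGraph

/-! ### Connectivity after deleting vertices -/

variable {V : Type*}

/-- The graph obtained from `G` by isolating all vertices in `S`. -/
def avoiding (G : SimpleGraph V) (S : Finset V) : SimpleGraph V where
  Adj u w := G.Adj u w ∧ u ∉ S ∧ w ∉ S
  symm := ⟨fun _ _ h => ⟨h.1.symm, h.2.2, h.2.1⟩⟩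
  loopless := ⟨fun _ h => G.irrefl h.1⟩

/-- The vertices outside `S` are connected to each other outside `S`. -/
def ConnectedOff (G : SimpleGraph V) (S : Finset V) : Prop :=
  ∀ u w, u ∉ S → w ∉ S → (G.avoiding S).Reachable u w

variable {G : SimpleGraph V} {S : Finset V} {u v w : V}

theorem Reachable.rec_adj {H : SimpleGraph V} {P : V → Prop} (h : H.Reachable u w) (h0 : P u)
    (hs : ∀ a b, P a → H.Adj a b → P b) : P w := by
  rw [reachable_iff_reflTransGen] at h
  induction h with
  | refl => exact h0
  | tail _ hab ih => exact hs _ _ ih hab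

theorem Reachable.notMem_of_avoiding (h : (G.avoiding S).Reachable u w) (hu : u ∉ S) : w ∉ S :=
  h.rec_adj hu fun _ _ _ hab => hab.2.2

theorem Reachable.eq_of_avoiding (h : (G.avoiding S).Reachable u w) (hu : u ∈ S) : w = u :=
  h.rec_adj (P := (· = u)) rfl fun _ _ ha hab => absurd (ha ▸ hu) hab.2.1

/-- Isolating vertices instead of removing them keeps the vertex type fixed, so walks off different
sets can be compared without subtypes. -/
theorem preconnected_induce_notMem_iff :
    (G.induce {v | v ∉ S}).Preconnected ↔ G.ConnectedOff S := by
  constructor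
  · intro h u w hu hw
    let f : G.induce {v | v ∉ S} →g G.avoiding S :=
      ⟨fun v => v.1, fun {a b} hab => ⟨hab, a.2, b.2⟩⟩
    exact (h ⟨u, hu⟩ ⟨w, hw⟩).map f
  · rintro h ⟨u, hu⟩ ⟨w, hw⟩
    have := (h u w hu hw).rec_adj
      (P := fun t => ∃ ht : t ∉ S, (G.induce {v | v ∉ S}).Reachable ⟨u, hu⟩ ⟨t, ht⟩) ⟨hu, .refl _⟩
      (fun a b ⟨ha, hr⟩ hab => ⟨hab.2.2, hr.trans (Adj.reachable hab.1)⟩)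
    exact this.2

variable [DecidableEq V]

theorem reachable_avoiding_insert_or (hw : w ∉ insert v S) (h : (G.avoiding S).Reachable w u) :
    (G.avoiding (insert v S)).Reachable w u ∨
      ∃ t, G.Adj v t ∧ t ∉ insert v S ∧ (G.avoiding (insert v S)).Reachable w t := by
  refine h.rec_adj (P := fun u => (G.avoiding (insert v S)).Reachable w u ∨
    ∃ t, G.Adj v t ∧ t ∉ insert v S ∧ (G.avoiding (insert v S)).Reachable w t)
    (Or.inl (.refl _)) ?_
  rintro a b (ha | ha) hab
  · by_cases hb : b = v
    · subst hb
      exact .inr ⟨a, hab.1.symm, ha.notMem_of_avoiding hw, ha⟩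
    · refine .inl (ha.trans (Adj.reachable ⟨hab.1, ha.notMem_of_avoiding hw, ?_⟩))
      simp [hb, hab.2.2]
  · exact .inr ha

theorem exists_adj_reachable_of_connectedOff (h : G.ConnectedOff S) (hv : v ∉ S)
    (hw : w ∉ insert v S) :
    ∃ t, G.Adj v t ∧ t ∉ insert v S ∧ (G.avoiding (insert v S)).Reachable w t := by
  refine (reachable_avoiding_insert_or hw (h w v (fun h => hw (by simp [h])) hv)).resolve_left ?_
  intro h
  exact h.notMem_of_avoiding hw (by simp)

/-- Every component left after also deleting `v` contains a neighbour of `v`, so it is enough to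
link these neighbours. -/
theorem ConnectedOff.insert (h : G.ConnectedOff S) (hv : v ∉ S)
    (hlink : ∀ s t, G.Adj v s → G.Adj v t → s ∉ insert v S → t ∉ insert v S →
      (G.avoiding (insert v S)).Reachable s t) : G.ConnectedOff (insert v S) := by
  intro u w hu hw
  obtain ⟨s, hs, hs', hus⟩ := exists_adj_reachable_of_connectedOff h hv hu
  obtain ⟨t, ht, ht', hwt⟩ := exists_adj_reachable_of_connectedOff h hv hw
  exact hus.trans ((hlink s t hs ht hs' ht').trans hwt.symm)

end SimpleGraph

/-! ### Removing a point from a cycle and inserting one -/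

namespace Equiv.Perm

variable {α : Type*} {σ : Perm α} {s : Set α} {p q : α}

theorem sameCycle_of_forall {τ : Perm α} (h : ∀ u ∈ s, τ.SameCycle p u) :
    ∀ ⦃u⦄, u ∈ s → ∀ ⦃v⦄, v ∈ s → τ.SameCycle u v :=
  fun _ hu _ hv => (h _ hu).symm.trans (h _ hv)

variable [Finite α]

/-- The induction starts just after `p` and reaches `p` last, which suits walking along a cycle cut
open at `p`. -/
theorem IsCycleOn.induction_apply {P : α → Prop} (h : σ.IsCycleOn s) (hp : p ∈ s) (h0 : P (σ p))
    (hs : ∀ u ∈ s, P u → P (σ u)) {u : α} (hu : u ∈ s) : P u := by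
  have key : ∀ n : ℕ, P ((σ ^ (n + 1)) p) := by
    intro n
    induction n with
    | zero => simpa using h0
    | succ n ih =>
      rw [pow_succ', mul_apply]
      exact hs _ ((h.1.perm_pow _).mapsTo hp) ih
  obtain ⟨n, hn, -, rfl⟩ := (h.2 hp hu).exists_pow_eq''
  obtain ⟨m, rfl⟩ := Nat.exists_eq_succ_of_ne_zero hn.ne'
  exact key m

theorem bijOn_of_mapsTo_of_finite {τ : Perm α} (h : Set.MapsTo τ s s) : Set.BijOn τ s s :=
  (s.toFinite.injOn_iff_bijOn_of_mapsTo h).1 τ.injective.injOn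

variable [DecidableEq α]

theorem IsCycleOn.mul_swap_diff (h : σ.IsCycleOn s) (hp : p ∈ s) (hpq : σ p = q) (hne : p ≠ q) :
    (σ * swap p q).IsCycleOn (s \ {q}) := by
  have hmap := h.1.mapsTo
  have hτp : (σ * swap p q) p = σ q := by simp
  have hτ : ∀ u, u ≠ p → u ≠ q → (σ * swap p q) u = σ u := fun u h1 h2 => by
    simp [swap_apply_of_ne_of_ne h1 h2]
  refine ⟨bijOn_of_mapsTo_of_finite ?_, sameCycle_of_forall (p := p) ?_⟩
  · rintro u ⟨hu, huq⟩
    have huq : u ≠ q := huq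
    by_cases hup : u = p
    · subst hup
      refine ⟨hτp ▸ hmap (hpq ▸ hmap hp), fun e => ?_⟩
      have e : σ q = q := hτp ▸ e
      exact hne (σ.injective (hpq.trans e.symm))
    · rw [hτ u hup huq]
      exact ⟨hmap hu, fun e => hup (σ.injective (Eq.trans e hpq.symm))⟩
  · have : ∀ u ∈ s, u = q ∨ (σ * swap p q).SameCycle p u := by
      intro u hu
      refine h.induction_apply (P := fun u => u = q ∨ (σ * swap p q).SameCycle p u) hp
        (.inl hpq) ?_ hu
      rintro u hu (rfl | hs)
      · right
        rw [← hτp]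
        exact sameCycle_apply_right.2 (.refl _ _)
      · by_cases hup : u = p
        · exact .inl (hup ▸ hpq)
        · by_cases huq : u = q
          · subst huq
            right
            rw [← hτp]
            exact sameCycle_apply_right.2 (.refl _ _)
          · right
            rw [← hτ u hup huq]
            exact sameCycle_apply_right.2 hs
    exact fun u hu => (this u hu.1).resolve_left hu.2

theorem IsCycleOn.mul_swap_insert (h : σ.IsCycleOn s) (hp : p ∈ s) (hq : q ∉ s) (hσq : σ q = q) :
    (σ * swap p q).IsCycleOn (insert q s) := by
  have hmap := h.1.mapsTo
  have hτp : (σ * swap p q) p = q := by simp [hσq]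
  have hτq : (σ * swap p q) q = σ p := by simp
  have hτ : ∀ u, u ≠ p → u ≠ q → (σ * swap p q) u = σ u := fun u h1 h2 => by
    simp [swap_apply_of_ne_of_ne h1 h2]
  have hpq : (σ * swap p q).SameCycle p q := by
    simpa only [hτp] using sameCycle_apply_right.2 (SameCycle.refl (σ * swap p q) p)
  have hps : (σ * swap p q).SameCycle p (σ p) := by
    simpa only [hτq] using sameCycle_apply_right.2 hpq
  refine ⟨bijOn_of_mapsTo_of_finite ?_, sameCycle_of_forall (p := p) ?_⟩
  · intro u hu
    by_cases hup : u = p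
    · subst hup
      simp [hτp]
    by_cases huq : u = q
    · subst huq
      rw [hτq]
      exact .inr (hmap hp)
    · rw [hτ u hup huq]
      exact .inr (hmap (hu.resolve_left huq))
  · rintro u (rfl | hu)
    · exact hpq
    · refine h.induction_apply (P := fun u => (σ * swap p q).SameCycle p u) hp hps ?_ hu
      intro u hu hs
      by_cases hup : u = p
      · exact hup ▸ hps
      · rw [← hτ u hup (fun e => hq (e ▸ hu))]
        exact sameCycle_apply_right.2 hs

end Equiv.Perm

theorem Finset.exists_eq_triple_of_mem {α : Type*} [DecidableEq α] {D : Finset α} {x y : α}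
    (hD : D.card = 3) (hx : x ∈ D) (hy : y ∈ D) (hxy : x ≠ y) :
    ∃ z, z ≠ x ∧ z ≠ y ∧ D = {x, y, z} := by
  have h1 : ((D.erase x).erase y).card = 1 := by
    rw [card_erase_of_mem (mem_erase.2 ⟨hxy.symm, hy⟩), card_erase_of_mem hx, hD]
  obtain ⟨z, hz⟩ := card_eq_one.1 h1
  have hzm : z ∈ (D.erase x).erase y := by simp [hz]
  simp only [mem_erase] at hzm
  refine ⟨z, hzm.2.1, hzm.1, ?_⟩
  rw [← hz, insert_erase (mem_erase.2 ⟨hxy.symm, hy⟩), insert_erase hx]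

/-! ### Vertex links and separating triangles -/

namespace Triangulation

open SimpleGraph

variable {V : Type*} (T : Triangulation V) {u v w x y z : V} {D S : Finset V}

theorem rot_rot (h : T.graph.Adj u v) : T.rot (T.rot v u) v = u := by
  have h3 : T.facePerm^[3] ⟨(u, v), h⟩ = ⟨(u, v), h⟩ := by
    rw [← T.face_length ⟨(u, v), h⟩]
    exact Function.iterate_minimalPeriod
  exact congrArg (fun d : T.graph.Dart => d.fst) h3

theorem rot_rot_left (h : T.graph.Adj u v) : T.rot u (T.rot v u) = v := by
  have := T.rot_rot (T.adj_rot h.symm)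
  rwa [T.rot_rot h] at this

theorem adj_rot_right (h : T.graph.Adj v u) : T.graph.Adj u (T.rot v u) := by
  have := T.adj_rot (T.adj_rot h).symm
  rw [T.rot_rot h.symm] at this
  exact this.symm

theorem rot_ne (h : T.graph.Adj v u) : T.rot v u ≠ u := (T.adj_rot_right h).ne'

theorem connectedOff_empty : T.graph.ConnectedOff ∅ := by
  intro u w _ _
  exact (T.connected.preconnected u w).rec_adj (.refl _) fun a b ha hab =>
    ha.trans (Adj.reachable ⟨hab, by simp, by simp⟩)

theorem isSeparatingTriangle_iff :
    T.graph.IsSeparatingTriangle D ↔ T.graph.IsNClique 3 D ∧ ¬ T.graph.ConnectedOff D := by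
  rw [IsSeparatingTriangle, preconnected_induce_notMem_iff]

variable [Finite V]

/-- Consecutive neighbours of `v` are adjacent, so deleting at most `p` and `q` from the link leaves
at most two arcs, which begin right after `p` and `q`. -/
theorem reachable_rot_or {p q : V} (hp : T.graph.Adj v p)
    (hS : ∀ u ∈ S, T.graph.Adj v u → u = p ∨ u = q) (hu : T.graph.Adj v u) (huS : u ∉ S) :
    (T.graph.avoiding S).Reachable (T.rot v p) u ∨
      (T.graph.avoiding S).Reachable (T.rot v q) u := by
  refine ((T.rot_isCycleOn v).induction_apply (P := fun u => u ∈ S ∨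
    (T.graph.avoiding S).Reachable (T.rot v p) u ∨ (T.graph.avoiding S).Reachable (T.rot v q) u)
    hp (.inr (.inl (.refl _))) ?_ hu).resolve_left huS
  intro u hu h
  by_cases huS : u ∈ S
  · obtain rfl | rfl := hS u huS hu
    · exact .inr (.inl (.refl _))
    · exact .inr (.inr (.refl _))
  · by_cases huS' : T.rot v u ∈ S
    · exact .inl huS'
    · have hadj : (T.graph.avoiding S).Adj u (T.rot v u) := ⟨T.adj_rot_right hu, huS, huS'⟩
      exact .inr ((h.resolve_left huS).imp (·.trans hadj.reachable) (·.trans hadj.reachable))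

variable [DecidableEq V]

/-- A cycle minus at most one vertex is connected, so the surviving neighbours of `v` stay linked
along its link. -/
theorem connectedOff_insert [Nontrivial V] (h : T.graph.ConnectedOff S) (hv : v ∉ S)
    (hS : ∀ s ∈ S, ∀ t ∈ S, T.graph.Adj v s → T.graph.Adj v t → s = t) :
    T.graph.ConnectedOff (insert v S) := by
  have : ∃ p, T.graph.Adj v p ∧ ∀ u ∈ insert v S, T.graph.Adj v u → u = p ∨ u = p := by
    by_cases hnb : ∃ p ∈ S, T.graph.Adj v p
    · obtain ⟨p, hpS, hp⟩ := hnb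
      refine ⟨p, hp, fun u hu huv => ?_⟩
      obtain rfl | hu := Finset.mem_insert.1 hu
      · exact absurd huv (T.graph.irrefl)
      · exact .inl (hS u hu p hpS huv hp)
    · obtain ⟨p, hp⟩ := T.connected.preconnected.exists_adj_of_nontrivial v
      refine ⟨p, hp, fun u hu huv => ?_⟩
      obtain rfl | hu := Finset.mem_insert.1 hu
      · exact absurd huv (T.graph.irrefl)
      · exact absurd ⟨u, hu, huv⟩ hnb
  obtain ⟨p, hp, hpS⟩ := this
  refine h.insert hv fun s t hs ht hs' ht' => ?_
  have h1 := (T.reachable_rot_or hp hpS hs hs').elim id id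
  have h2 := (T.reachable_rot_or hp hpS ht ht').elim id id
  exact h1.symm.trans h2

theorem connectedOff_of_card_le_two [Nontrivial V] (hS : S.card ≤ 2) :
    T.graph.ConnectedOff S := by
  have h1 : ∀ v, T.graph.ConnectedOff {v} := fun v =>
    T.connectedOff_insert T.connectedOff_empty (by simp) (by simp)
  interval_cases h : S.card
  · rw [Finset.card_eq_zero.1 h]
    exact T.connectedOff_empty
  · obtain ⟨v, rfl⟩ := Finset.card_eq_one.1 h
    exact h1 v
  · obtain ⟨u, v, huv, rfl⟩ := Finset.card_eq_two.1 h
    exact T.connectedOff_insert (h1 v) (by simpa) (by simp)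

theorem connectedOff_of_not_adj [Nontrivial V] (hS : S.card = 3) (hx : x ∈ S) (hy : y ∈ S)
    (hxy : x ≠ y) (hadj : ¬ T.graph.Adj x y) : T.graph.ConnectedOff S := by
  obtain ⟨z, hzx, hzy, rfl⟩ := Finset.exists_eq_triple_of_mem hS hx hy hxy
  refine T.connectedOff_insert (T.connectedOff_of_card_le_two Finset.card_le_two)
    (by simp [hxy, hzx.symm]) ?_
  simp [hadj]

theorem isKVertexConnected_four [Fintype V] (hn : 5 ≤ Fintype.card V)
    (h : ∀ D, ¬ T.graph.IsSeparatingTriangle D) : T.graph.IsKVertexConnected 4 := by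
  have : Nontrivial V := Fintype.one_lt_card_iff_nontrivial.1 (by lia)
  refine ⟨by rw [ENat.card_eq_coe_fintype_card]; exact_mod_cast hn, fun S hS => ?_⟩
  have hconn : T.graph.ConnectedOff S := by
    by_cases h2 : S.card ≤ 2
    · exact T.connectedOff_of_card_le_two h2
    have h3 : S.card = 3 := by lia
    by_cases hc : T.graph.IsNClique 3 S
    · by_contra hcon
      exact h S (T.isSeparatingTriangle_iff.2 ⟨hc, hcon⟩)
    · simp only [isNClique_iff, h3, and_true, IsClique, Set.Pairwise] at hc
      push Not at hc
      obtain ⟨x, hx, y, hy, hxy, hadj⟩ := hc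
      exact T.connectedOff_of_not_adj h3 hx hy hxy hadj
  obtain ⟨v, hv⟩ : ∃ v, v ∉ S := by
    by_contra! hall
    have := Finset.card_le_card (fun v _ => hall v : Finset.univ ⊆ S)
    rw [Finset.card_univ] at this
    lia
  exact @Connected.mk _ _ (preconnected_induce_notMem_iff.2 hconn) ⟨⟨v, hv⟩⟩

/-- Every vertex of a triangle has a neighbour in each component of its complement. -/
theorem exists_adj_reachable [Nontrivial V] (hD : D.card = 3) (hx : x ∈ D) (hw : w ∉ D) :
    ∃ t, T.graph.Adj x t ∧ t ∉ D ∧ (T.graph.avoiding D).Reachable w t := by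
  have h := T.connectedOff_of_card_le_two (S := D.erase x)
    (by rw [Finset.card_erase_of_mem hx, hD])
  have := exists_adj_reachable_of_connectedOff (v := x) (w := w) h (by simp)
    (by rwa [Finset.insert_erase hx])
  rwa [Finset.insert_erase hx] at this

/-- A triangle leaves at most two components: each one touches `x`, and the other two vertices cut
the link of `x` into at most two arcs. -/
theorem reachable_of_notMem_triangle [Nontrivial V] (hxy : T.graph.Adj x y) (hzx : z ≠ x)
    (hzy : z ≠ y) (hw : w ∉ ({x, y, z} : Finset V)) :
    (T.graph.avoiding {x, y, z}).Reachable (T.rot x y) w ∨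
      (T.graph.avoiding {x, y, z}).Reachable (T.rot x z) w := by
  obtain ⟨t, ht, ht', hwt⟩ := T.exists_adj_reachable (D := {x, y, z}) (x := x)
    (Finset.card_eq_three.2 ⟨x, y, z, hxy.ne, hzx.symm, hzy.symm, rfl⟩) (by simp) hw
  refine (T.reachable_rot_or (q := z) hxy ?_ ht ht').imp (·.trans hwt.symm) (·.trans hwt.symm)
  simp

theorem connectedOff_face [Nontrivial V] (h : T.graph.Adj x y) :
    T.graph.ConnectedOff {x, y, T.rot y x} := by
  have key : ∀ w ∉ ({x, y, T.rot y x} : Finset V),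
      (T.graph.avoiding {x, y, T.rot y x}).Reachable (T.rot x y) w := by
    intro w hw
    refine (T.reachable_of_notMem_triangle h (T.adj_rot_right h.symm).ne'
      (T.adj_rot h.symm).ne' hw).resolve_right fun hr => ?_
    rw [T.rot_rot_left h] at hr
    rw [hr.eq_of_avoiding (by simp)] at hw
    simp at hw
  exact fun u w hu hw => (key u hu).symm.trans (key w hw)

/-- The two apexes of the faces at an edge of a separating triangle are separated by it. -/
theorem rot_notMem_of_isSeparatingTriangle [Nontrivial V] (h : T.graph.IsSeparatingTriangle D)
    (hx : x ∈ D) (hy : y ∈ D) (hxy : T.graph.Adj x y) : T.rot y x ∉ D := by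
  rw [isSeparatingTriangle_iff] at h
  obtain ⟨z, hzx, hzy, rfl⟩ := Finset.exists_eq_triple_of_mem h.1.card_eq hx hy hxy.ne
  simp only [Finset.mem_insert, Finset.mem_singleton, not_or]
  refine ⟨(T.adj_rot_right hxy.symm).ne', (T.adj_rot hxy.symm).ne', ?_⟩
  rintro rfl
  exact h.2 (T.connectedOff_face hxy)

theorem not_reachable_of_isSeparatingTriangle [Nontrivial V]
    (h : T.graph.IsSeparatingTriangle D) (hx : x ∈ D) (hy : y ∈ D) (hxy : T.graph.Adj x y) :
    ¬ (T.graph.avoiding D).Reachable (T.rot y x) (T.rot x y) := by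
  intro hr
  have ha := T.rot_notMem_of_isSeparatingTriangle h hx hy hxy
  have hb := T.rot_notMem_of_isSeparatingTriangle h hy hx hxy.symm
  rw [isSeparatingTriangle_iff] at h
  obtain ⟨z, hzx, hzy, rfl⟩ := Finset.exists_eq_triple_of_mem h.1.card_eq hx hy hxy.ne
  have hxz : T.graph.Adj x z := h.1.isClique (by simp) (by simp) hzx.symm
  have hzD : T.rot x z ∉ ({x, y, z} : Finset V) := by
    simp only [Finset.mem_insert, Finset.mem_singleton, not_or]
    refine ⟨(T.adj_rot hxz).ne', fun e => ?_, T.rot_ne hxz⟩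
    have : z = T.rot y x := (T.rot x).injective (e.trans (T.rot_rot_left hxy).symm)
    simp [this] at ha
  have hz : ¬ (T.graph.avoiding {x, y, z}).Reachable (T.rot x z) (T.rot x y) := by
    intro hz
    have key : ∀ w ∉ ({x, y, z} : Finset V),
        (T.graph.avoiding {x, y, z}).Reachable (T.rot x y) w := fun w hw =>
      (T.reachable_of_notMem_triangle hxy hzx hzy hw).elim id fun h => hz.symm.trans h
    exact h.2 fun u w hu hw => (key u hu).symm.trans (key w hw)
  -- Go around `x` starting after `z`. The only way to enter `y` is from `T.rot y x`, which is
  -- assumed to lie on the other side, so `y` would never be reached.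
  have := (T.rot_isCycleOn x).induction_apply
    (P := fun u => u = z ∨ (T.graph.avoiding {x, y, z}).Reachable (T.rot x z) u)
    hxz (.inr (.refl _)) ?_ hxy
  · obtain rfl | h := this
    · exact hzy rfl
    · exact h.notMem_of_avoiding hzD (by simp)
  · rintro u hu (rfl | hs)
    · exact .inr (.refl _)
    · by_cases hz' : T.rot x u = z
      · exact .inl hz'
      · refine .inr (hs.trans (Adj.reachable ⟨T.adj_rot_right hu, hs.notMem_of_avoiding hzD, ?_⟩))
        simp only [Finset.mem_insert, Finset.mem_singleton, not_or]
        refine ⟨(T.adj_rot hu).ne', fun e => ?_, hz'⟩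
        have : u = T.rot y x := (T.rot x).injective (e.trans (T.rot_rot_left hxy).symm)
        exact hz (hs.trans (this ▸ hr))

end Triangulation

/-! ### Counting faces -/

theorem Equiv.Perm.mul_card_quotient_sameCycle {α : Type*} [Finite α] {σ : Equiv.Perm α} {k : ℕ}
    (h : ∀ d, Function.minimalPeriod σ d = k) :
    k * Nat.card (Quotient (SameCycle.setoid σ)) = Nat.card α := by
  have := Fintype.ofFinite α
  have := Fintype.ofFinite (Quotient (SameCycle.setoid σ))
  have hfib : ∀ q : Quotient (SameCycle.setoid σ),
      Nat.card {d : α // Quotient.mk (SameCycle.setoid σ) d = q} = k := by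
    intro q
    obtain ⟨d, rfl⟩ := Quotient.exists_rep q
    have := Fintype.ofFinite (MulAction.orbit (Subgroup.zpowers σ) d)
    rw [← h d]
    have hc := MulAction.minimalPeriod_eq_card σ d
    refine Eq.trans ?_ (Eq.trans Nat.card_eq_fintype_card hc.symm)
    refine Nat.card_congr (Equiv.subtypeEquivRight fun e => ?_)
    rw [Quotient.eq, MulAction.mem_orbit_iff]
    constructor
    · intro hs
      obtain ⟨i, hi⟩ := SameCycle.symm hs
      exact ⟨⟨σ ^ i, i, rfl⟩, hi⟩
    · rintro ⟨⟨_, i, rfl⟩, hi⟩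
      exact SameCycle.symm ⟨i, hi⟩
  rw [Nat.card_congr (Equiv.sigmaFiberEquiv (Quotient.mk (SameCycle.setoid σ))).symm,
    Nat.card_sigma]
  simp [hfib, mul_comm]

namespace RotationSystem

variable {V : Type*} [Finite V] {R : RotationSystem V}

theorem three_mul_card_face (h : ∀ d, Function.minimalPeriod R.facePerm d = 3) :
    3 * Nat.card R.Face = 2 * Nat.card R.graph.edgeSet := by
  classical
  have := Fintype.ofFinite V
  refine (Equiv.Perm.mul_card_quotient_sameCycle h).trans ?_
  rw [Nat.card_eq_fintype_card, R.graph.dart_card_eq_twice_card_edges, Nat.card_eq_fintype_card,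
    SimpleGraph.edgeFinset_card]

omit [Finite V] in
theorem minimalPeriod_facePerm_eq_three
    (h : ∀ u v, R.graph.Adj u v → R.rot (R.rot v u) v = u) (d : R.graph.Dart) :
    Function.minimalPeriod R.facePerm d = 3 := by
  have := Fact.mk Nat.prime_three
  refine Function.minimalPeriod_eq_prime ?_ ?_
  · obtain ⟨⟨u, v⟩, hd⟩ := d
    have hd' : R.graph.Adj u v := hd
    have h1 := h u v hd
    have h2 := h v (R.rot v u) (R.adj_rot hd'.symm)
    rw [h1] at h2
    simp only [Function.IsPeriodicPt, Function.IsFixedPt, Function.iterate_succ,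
      Function.iterate_zero, Function.comp, facePerm, Equiv.coe_fn_mk, id]
    ext <;> simp [h1, h2]
  · intro hfix
    have : (R.facePerm d).fst = d.fst := by rw [hfix]
    exact d.adj.ne' this

end RotationSystem

/-! ### Construction of the flip -/

namespace SimpleGraph

variable {V : Type*} {G : SimpleGraph V} {x y a b u v : V}

theorem adj_deleteEdges_sup_edge (hab : a ≠ b) :
    (G.deleteEdges {s(x, y)} ⊔ edge a b).Adj u v ↔
      (G.Adj u v ∧ ¬ (u = x ∧ v = y ∨ u = y ∧ v = x)) ∨ (u = a ∧ v = b ∨ u = b ∧ v = a) := by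
  simp only [sup_adj, deleteEdges_adj, edge_adj, Set.mem_singleton_iff, Sym2.eq_iff]
  refine or_congr Iff.rfl ⟨fun h => by tauto, fun h => ⟨by tauto, ?_⟩⟩
  rintro rfl
  grind

theorem deleteEdges_sup_edge_comm :
    G.deleteEdges {s(x, y)} ⊔ edge a b = G.deleteEdges {s(y, x)} ⊔ edge b a := by
  rw [Sym2.eq_swap, edge_comm]

theorem card_edgeSet_deleteEdges_sup_edge [Finite V] (hxy : G.Adj x y) (hab : a ≠ b)
    (h : ¬ G.Adj a b) :
    Nat.card (G.deleteEdges {s(x, y)} ⊔ edge a b).edgeSet = Nat.card G.edgeSet := by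
  have hset : (G.deleteEdges {s(x, y)} ⊔ edge a b).edgeSet =
      insert s(a, b) (G.edgeSet \ {s(x, y)}) := by
    rw [edgeSet_sup, edgeSet_deleteEdges, edgeSet_edge_of_ne hab, Set.union_comm]
    rfl
  rw [hset, Nat.card_coe_set_eq, Nat.card_coe_set_eq,
    Set.ncard_insert_of_notMem (fun hm => h hm.1),
    Set.ncard_sdiff_singleton_add_one (by exact hxy) G.edgeSet.toFinite]

end SimpleGraph

namespace Triangulation

open SimpleGraph Equiv

variable {V : Type*} (T : Triangulation V) {x y a b : V}

/-- An edge whose two apexes `a = rot y x` and `b = rot x y` are distinct and not adjacent. -/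
structure Flippable (x y a b : V) : Prop where
  adj : T.graph.Adj x y
  left : T.rot y x = a
  right : T.rot x y = b
  ne : a ≠ b
  not_adj : ¬ T.graph.Adj a b

namespace Flippable

variable {T} (h : T.Flippable x y a b)
include h

theorem symm : T.Flippable y x b a :=
  ⟨h.adj.symm, h.right, h.left, h.ne.symm, fun e => h.not_adj e.symm⟩

theorem adj_xa : T.graph.Adj x a := h.left ▸ T.adj_rot_right h.adj.symm
theorem adj_ya : T.graph.Adj y a := h.left ▸ T.adj_rot h.adj.symm
theorem adj_xb : T.graph.Adj x b := h.symm.adj_ya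
theorem adj_yb : T.graph.Adj y b := h.symm.adj_xa

theorem rot_xa : T.rot x a = y := by rw [← h.left, T.rot_rot_left h.adj]
theorem rot_ay : T.rot a y = x := by rw [← h.left, T.rot_rot h.adj]
theorem rot_ab : T.rot a b = b := T.rot_eq_self _ _ h.not_adj

end Flippable

variable [DecidableEq V]

/-- The rotation after flipping `xy` to `ab`. -/
def flipRot (x y a b v : V) : Perm V :=
  if v = x then T.rot x * swap a y
  else if v = y then T.rot y * swap b x
  else if v = a then T.rot a * swap y b
  else if v = b then T.rot b * swap x a
  else T.rot v

theorem flipRot_apply_of_not {v u : V} (hx : v = x → u ≠ a ∧ u ≠ y) (hy : v = y → u ≠ b ∧ u ≠ x)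
    (ha : v = a → u ≠ y ∧ u ≠ b) (hb : v = b → u ≠ x ∧ u ≠ a) :
    T.flipRot x y a b v u = T.rot v u := by
  unfold flipRot
  split_ifs with h1 h2 h3 h4
  · rw [Perm.mul_apply, swap_apply_of_ne_of_ne (hx h1).1 (hx h1).2, h1]
  · rw [Perm.mul_apply, swap_apply_of_ne_of_ne (hy h2).1 (hy h2).2, h2]
  · rw [Perm.mul_apply, swap_apply_of_ne_of_ne (ha h3).1 (ha h3).2, h3]
  · rw [Perm.mul_apply, swap_apply_of_ne_of_ne (hb h4).1 (hb h4).2, h4]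
  · rfl

theorem flipRot_x : T.flipRot x y a b x = T.rot x * swap a y := by simp [flipRot]

theorem flipRot_of_ne {v : V} (hx : v ≠ x) (hy : v ≠ y) (ha : v ≠ a) (hb : v ≠ b) :
    T.flipRot x y a b v = T.rot v := by
  simp [flipRot, hx, hy, ha, hb]

namespace Flippable

variable {T} (h : T.Flippable x y a b)
include h

/-- The half-turn of the quadrilateral; it halves the number of verifications below. -/
theorem flipRot_comm : T.flipRot x y a b = T.flipRot y x b a := by
  funext v
  have := h.adj.ne
  have := h.adj_xa.ne
  have := h.adj_xb.ne
  have := h.adj_ya.ne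
  have := h.adj_yb.ne
  have := h.ne
  unfold flipRot
  split_ifs <;> simp_all

theorem flipRot_y : T.flipRot x y a b y = T.rot y * swap b x := by
  rw [h.flipRot_comm, flipRot_x]

theorem flipRot_a : T.flipRot x y a b a = T.rot a * swap y b := by
  simp [flipRot, h.adj_xa.ne', h.adj_ya.ne']

theorem flipRot_b : T.flipRot x y a b b = T.rot b * swap x a := by
  rw [h.flipRot_comm, h.symm.flipRot_a]

theorem flipRot_x_a : T.flipRot x y a b x a = b := by simp [flipRot_x, h.right]
theorem flipRot_x_y : T.flipRot x y a b x y = y := by simp [flipRot_x, h.rot_xa]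
theorem flipRot_a_y : T.flipRot x y a b a y = b := by simp [h.flipRot_a, h.rot_ab]
theorem flipRot_a_b : T.flipRot x y a b a b = x := by simp [h.flipRot_a, h.rot_ay]
theorem flipRot_y_b : T.flipRot x y a b y b = a := by rw [h.flipRot_comm, h.symm.flipRot_x_a]
theorem flipRot_y_x : T.flipRot x y a b y x = x := by rw [h.flipRot_comm, h.symm.flipRot_x_y]
theorem flipRot_b_x : T.flipRot x y a b b x = a := by rw [h.flipRot_comm, h.symm.flipRot_a_y]
theorem flipRot_b_a : T.flipRot x y a b b a = y := by rw [h.flipRot_comm, h.symm.flipRot_a_b]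

theorem isCycleOn_x [Finite V] : (T.flipRot x y a b x).IsCycleOn
    ((T.graph.deleteEdges {s(x, y)} ⊔ edge a b).neighborSet x) := by
  rw [flipRot_x]
  convert (T.rot_isCycleOn x).mul_swap_diff h.adj_xa h.rot_xa h.adj_ya.ne' using 1
  ext w
  have := h.adj.ne
  have := h.adj_xa.ne
  have := h.adj_xb.ne
  simp only [mem_neighborSet, adj_deleteEdges_sup_edge h.ne, Set.mem_sdiff, Set.mem_singleton_iff]
  grind

theorem isCycleOn_a [Finite V] : (T.flipRot x y a b a).IsCycleOn
    ((T.graph.deleteEdges {s(x, y)} ⊔ edge a b).neighborSet a) := by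
  rw [h.flipRot_a]
  convert (T.rot_isCycleOn a).mul_swap_insert h.adj_ya.symm h.not_adj h.rot_ab using 1
  ext w
  have := h.ne
  have := h.adj_xa.ne
  have := h.adj_ya.ne
  simp only [mem_neighborSet, adj_deleteEdges_sup_edge h.ne, Set.mem_insert_iff]
  grind

/-- The rotation system obtained by a flip. -/
def flipRotationSystem [Finite V] : RotationSystem V where
  graph := T.graph.deleteEdges {s(x, y)} ⊔ edge a b
  rot := T.flipRot x y a b
  rot_isCycleOn v := by
    by_cases hx : v = x
    · exact hx ▸ h.isCycleOn_x
    by_cases hy : v = y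
    · rw [hy, h.flipRot_comm, deleteEdges_sup_edge_comm]
      exact h.symm.isCycleOn_x
    by_cases ha : v = a
    · exact ha ▸ h.isCycleOn_a
    by_cases hb : v = b
    · rw [hb, h.flipRot_comm, deleteEdges_sup_edge_comm]
      exact h.symm.isCycleOn_a
    rw [T.flipRot_of_ne hx hy ha hb]
    convert T.rot_isCycleOn v using 1
    ext w
    simp only [mem_neighborSet, adj_deleteEdges_sup_edge h.ne]
    grind
  rot_eq_self v w hvw := by
    rw [adj_deleteEdges_sup_edge h.ne] at hvw
    have := h.adj_xa
    have := h.adj_ya.symm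
    have := h.adj_yb
    have := h.adj_xb.symm
    by_cases h1 : v = x ∧ w = y
    · rw [h1.1, h1.2, h.flipRot_x_y]
    by_cases h2 : v = y ∧ w = x
    · rw [h2.1, h2.2, h.flipRot_y_x]
    have hnadj : ¬ T.graph.Adj v w := by tauto
    rw [T.flipRot_apply_of_not, T.rot_eq_self _ _ hnadj]
    all_goals grind

/-- The six exceptional cases are the directed edges of the two new faces; at every other directed
edge both rotation values are the old ones. -/
theorem flipRot_flipRot {u v : V} (huv : (T.graph.deleteEdges {s(x, y)} ⊔ edge a b).Adj u v) :
    T.flipRot x y a b (T.flipRot x y a b v u) v = u := by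
  rw [adj_deleteEdges_sup_edge h.ne] at huv
  have hne := h.ne
  have h1 := h.adj.ne
  have h2 := h.adj_xa.ne
  have h3 := h.adj_xb.ne
  have h4 := h.adj_ya.ne
  have h5 := h.adj_yb.ne
  by_cases e1 : v = x ∧ u = a
  · rw [e1.1, e1.2, h.flipRot_x_a, h.flipRot_b_x]
  by_cases e2 : v = y ∧ u = b
  · rw [e2.1, e2.2, h.flipRot_y_b, h.flipRot_a_y]
  by_cases e3 : v = a ∧ u = y
  · rw [e3.1, e3.2, h.flipRot_a_y, h.flipRot_b_a]
  by_cases e4 : v = a ∧ u = b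
  · rw [e4.1, e4.2, h.flipRot_a_b, h.flipRot_x_a]
  by_cases e5 : v = b ∧ u = x
  · rw [e5.1, e5.2, h.flipRot_b_x, h.flipRot_a_b]
  by_cases e6 : v = b ∧ u = a
  · rw [e6.1, e6.2, h.flipRot_b_a, h.flipRot_y_b]
  have huv' : T.graph.Adj u v := by grind
  have hrr := T.rot_rot huv'
  have key : T.flipRot x y a b v u = T.rot v u := by
    apply T.flipRot_apply_of_not <;> grind
  have hadj := T.adj_rot huv'.symm
  have hinj := (T.rot v).injective
  have r1 := h.rot_xa
  have r2 := h.symm.rot_xa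
  have r3 := h.rot_ay
  have r4 := h.symm.rot_ay
  have r5 := h.left
  have r6 := h.right
  have hna := h.not_adj
  rw [key, T.flipRot_apply_of_not, hrr]
  · intro e
    rw [e] at hrr
    grind
  · intro e
    rw [e] at hrr
    grind
  · intro e
    rw [e] at hrr hadj
    exact ⟨by grind, fun e' => hna (e' ▸ hadj).symm⟩
  · intro e
    rw [e] at hrr hadj
    exact ⟨by grind, fun e' => hna (e' ▸ hadj)⟩

theorem connected_flip : (T.graph.deleteEdges {s(x, y)} ⊔ edge a b).Connected := by
  have := T.connected.nonempty
  refine ⟨fun u w => (T.connected.preconnected u w).rec_adj (.refl _) fun s t hs hst => ?_⟩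
  refine hs.trans ?_
  have hxa : (T.graph.deleteEdges {s(x, y)} ⊔ edge a b).Adj x a := by
    rw [adj_deleteEdges_sup_edge h.ne]
    exact .inl ⟨h.adj_xa, by have := h.adj_ya.ne; have := h.adj_xa.ne; grind⟩
  have hya : (T.graph.deleteEdges {s(x, y)} ⊔ edge a b).Adj y a := by
    rw [adj_deleteEdges_sup_edge h.ne]
    exact .inl ⟨h.adj_ya, by have := h.adj_ya.ne; have := h.adj_xa.ne; grind⟩
  by_cases e : s = x ∧ t = y ∨ s = y ∧ t = x
  · obtain ⟨rfl, rfl⟩ | ⟨rfl, rfl⟩ := e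
    · exact hxa.reachable.trans hya.symm.reachable
    · exact hya.reachable.trans hxa.symm.reachable
  · exact Adj.reachable ((adj_deleteEdges_sup_edge h.ne).2 (.inl ⟨hst, e⟩))

theorem exists_isFlipAt [Finite V] : ∃ T' : Triangulation V, T.IsFlipAt x y T' ∧
    T'.graph = T.graph.deleteEdges {s(x, y)} ⊔ edge a b ∧
    T'.rot b a = y ∧ T'.rot a b = x := by
  have hface : ∀ d, Function.minimalPeriod h.flipRotationSystem.facePerm d = 3 :=
    RotationSystem.minimalPeriod_facePerm_eq_three fun u v huv => h.flipRot_flipRot huv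
  refine ⟨{ toRotationSystem := h.flipRotationSystem
            connected := h.connected_flip
            euler := ?_
            face_length := hface }, ?_, rfl, h.flipRot_b_a, h.flipRot_a_b⟩
  -- The number of edges is unchanged, and `3F = 2E` before and after, so Euler's formula carries
  -- over.
  · have h1 := RotationSystem.three_mul_card_face hface
    have h2 := RotationSystem.three_mul_card_face T.face_length
    have h3 : Nat.card h.flipRotationSystem.graph.edgeSet = Nat.card T.graph.edgeSet :=
      card_edgeSet_deleteEdges_sup_edge h.adj h.ne h.not_adj
    have h4 := T.euler
    lia
  · unfold IsFlipAt
    simp only [h.left, h.right]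
    exact ⟨h.adj, h.ne, h.not_adj, rfl, T.flipRot_x, h.flipRot_y, h.flipRot_a, h.flipRot_b,
      fun v hx hy ha hb => T.flipRot_of_ne hx hy ha hb⟩

end Flippable

end Triangulation

/-! ### The effect of a flip on separating triangles -/

namespace SimpleGraph

variable {V : Type*} [DecidableEq V] {G G' : SimpleGraph V} {x y z a b w : V}

/-- If `a` and `b` lie on different sides of the triangle `xyz`, and the triangle `axz` is not
separating, then every vertex on the side of `a` can be joined to `y` off the triangle `abz`. -/
theorem reachable_avoiding_of_connectedOff
    (hle : ∀ u v, G.Adj u v → ¬ (u = x ∧ v = y ∨ u = y ∧ v = x) → G'.Adj u v)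
    (hab : ¬ (G.avoiding {x, y, z}).Reachable a b) (hwa : (G.avoiding {x, y, z}).Reachable w a)
    (hw : w ∉ ({x, y, z} : Finset V)) (hne : w ≠ a) (hc : G.ConnectedOff {a, x, z})
    (hyx : y ≠ x) (hyz : y ≠ z) (hya : y ≠ a) (hyb : y ≠ b) :
    (G'.avoiding {a, b, z}).Reachable w y := by
  by_contra hcon
  have hwy : (G.avoiding {a, x, z}).Reachable w y := by
    refine hc w y ?_ (by simp [hya, hyx, hyz])
    simp only [Finset.mem_insert, Finset.mem_singleton, not_or] at hw ⊢
    exact ⟨hne, hw.1, hw.2.2⟩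
  -- A walk avoiding `a`, `x`, `z` can leave the side of `a` only through `y`. Until then it misses
  -- `b`, and it never uses the edge `xy`.
  have key := hwy.rec_adj (P := fun t => (G.avoiding {x, y, z}).Reachable w t ∧
    (G'.avoiding {a, b, z}).Reachable w t) ⟨.refl _, .refl _⟩ ?_
  · exact hcon key.2
  rintro s t ⟨hs, hs'⟩ ⟨hst, hs1, ht1⟩
  have hsD := hs.notMem_of_avoiding hw
  have hsb : s ≠ b := by
    rintro rfl
    exact hab (hwa.symm.trans hs)
  simp only [Finset.mem_insert, Finset.mem_singleton, not_or] at hs1 ht1 hsD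
  have hst' : G'.Adj s t := hle s t hst (by rintro (⟨rfl, -⟩ | ⟨-, rfl⟩) <;> tauto)
  by_cases hty : t = y
  · subst hty
    refine absurd (hs'.trans (Adj.reachable ⟨hst', ?_, ?_⟩)) hcon <;> simp <;> tauto
  have ht : (G.avoiding {x, y, z}).Reachable w t :=
    hs.trans (Adj.reachable ⟨hst, by simp; tauto, by simp; tauto⟩)
  have htb : t ≠ b := by
    rintro rfl
    exact hab (hwa.symm.trans ht)
  exact ⟨ht, hs'.trans (Adj.reachable ⟨hst', by simp; tauto, by simp; tauto⟩)⟩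

end SimpleGraph

namespace Triangulation

open SimpleGraph

variable {V : Type*} {T T' : Triangulation V} {x y a b z w : V}

/-- `T'` arises from `T` by replacing the edge `xy` by the edge `ab`, and vice versa. -/
structure FlipPair (T T' : Triangulation V) (x y a b : V) : Prop where
  flippable : T.Flippable x y a b
  flippable' : T'.Flippable a b y x
  adj : ∀ u v, T.graph.Adj u v → ¬ (u = x ∧ v = y ∨ u = y ∧ v = x) → T'.graph.Adj u v
  adj' : ∀ u v, T'.graph.Adj u v → ¬ (u = a ∧ v = b ∨ u = b ∧ v = a) → T.graph.Adj u v

theorem Flippable.exists_flipPair [Finite V] [DecidableEq V] (h : T.Flippable x y a b) :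
    ∃ T' : Triangulation V, T.IsFlip T' ∧ FlipPair T T' x y a b := by
  obtain ⟨T', hflip, hg, hb, ha⟩ := h.exists_isFlipAt
  have hadj : ∀ {u v}, T'.graph.Adj u v ↔
      (T.graph.Adj u v ∧ ¬ (u = x ∧ v = y ∨ u = y ∧ v = x)) ∨ (u = a ∧ v = b ∨ u = b ∧ v = a) := by
    intro u v
    rw [hg, adj_deleteEdges_sup_edge h.ne]
  refine ⟨T', ⟨x, y, hflip⟩, h, ⟨hadj.2 (.inr (by simp)), hb, ha, h.adj.ne', ?_⟩, ?_, ?_⟩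
  · rw [hadj]
    have := h.adj_xa.ne
    have := h.adj_xb.ne
    grind
  · exact fun u v huv hne => hadj.2 (.inl ⟨huv, hne⟩)
  · intro u v huv hne
    exact ((hadj.1 huv).resolve_right hne).1

namespace FlipPair

variable (P : FlipPair T T' x y a b)
include P

/-- By this reversal, statements about surviving triangles also control newly created ones. -/
theorem symm : FlipPair T' T a b y x :=
  ⟨P.flippable', P.flippable.symm, P.adj', fun u v huv h => P.adj u v huv (by tauto)⟩

theorem swap : FlipPair T T' y x b a :=
  ⟨P.flippable.symm, P.flippable'.symm, fun u v huv h => P.adj u v huv (by tauto),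
    fun u v huv h => P.adj' u v huv (by tauto)⟩

variable {D E : Finset V}

/-- The lost edge `xy` is replaced by a detour through whichever of `a`, `b` lies outside `D`. -/
theorem reachable (hab : ¬ (a ∈ D ∧ b ∈ D)) {u v : V}
    (h : (T.graph.avoiding D).Reachable u v) : (T'.graph.avoiding D).Reachable u v := by
  refine h.rec_adj (.refl _) ?_
  rintro s t hs ⟨hst, hsD, htD⟩
  refine hs.trans ?_
  have key : x ∉ D → y ∉ D → (T'.graph.avoiding D).Reachable x y := by
    intro hx hy
    have h' := P.flippable'
    by_cases ha : a ∈ D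
    · have hb : b ∉ D := fun hb => hab ⟨ha, hb⟩
      exact .trans (Adj.reachable ⟨h'.adj_yb.symm, hx, hb⟩) (Adj.reachable ⟨h'.adj_ya, hb, hy⟩)
    · exact .trans (Adj.reachable ⟨h'.adj_xb.symm, hx, ha⟩) (Adj.reachable ⟨h'.adj_xa, ha, hy⟩)
  by_cases hne : s = x ∧ t = y ∨ s = y ∧ t = x
  · obtain ⟨rfl, rfl⟩ | ⟨rfl, rfl⟩ := hne
    · exact key hsD htD
    · exact (key htD hsD).symm
  · exact Adj.reachable ⟨P.adj s t hst hne, hsD, htD⟩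

theorem isSeparatingTriangle (h : T.graph.IsSeparatingTriangle D) (hxy : ¬ (x ∈ D ∧ y ∈ D)) :
    T'.graph.IsSeparatingTriangle D := by
  rw [isSeparatingTriangle_iff] at h ⊢
  refine ⟨⟨fun u hu v hv huv => P.adj u v (h.1.isClique hu hv huv) ?_, h.1.card_eq⟩, fun hc => ?_⟩
  · rintro (⟨rfl, rfl⟩ | ⟨rfl, rfl⟩)
    · exact hxy ⟨hu, hv⟩
    · exact hxy ⟨hv, hu⟩
  · exact h.2 fun u v hu hv => P.symm.reachable (by tauto) (hc u v hu hv)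

variable [Finite V] [DecidableEq V] [Nontrivial V]

/-- The triangle `abz` would separate the apexes `x` and `y` of the new edge, but `w` can be joined
to both of them off `abz`. -/
theorem not_isSeparatingTriangle_of_reachable (hzx : z ≠ x) (hzy : z ≠ y)
    (hD : T.graph.IsSeparatingTriangle {x, y, z})
    (hE : T'.graph.IsSeparatingTriangle {a, b, z})
    (hx : T.graph.ConnectedOff {a, x, z}) (hy : T.graph.ConnectedOff {a, y, z})
    (hw : w ∉ ({x, y, z} : Finset V)) (hwa : w ≠ a)
    (hr : (T.graph.avoiding {x, y, z}).Reachable w a) : False := by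
  have h := P.flippable
  have h' := P.flippable'
  have hab := T.not_reachable_of_isSeparatingTriangle hD (by simp) (by simp) h.adj
  have hyx := T'.not_reachable_of_isSeparatingTriangle hE (by simp) (by simp) h'.adj
  rw [h.left, h.right] at hab
  rw [h'.left, h'.right] at hyx
  have h1 := reachable_avoiding_of_connectedOff P.adj hab hr hw hwa hx h.adj.ne' hzy.symm
    h.adj_ya.ne h.adj_yb.ne
  rw [Finset.insert_comm] at hab hr hw
  have h2 := reachable_avoiding_of_connectedOff P.swap.adj hab hr hw hwa hy h.adj.ne hzx.symm
    h.adj_xa.ne h.adj_xb.ne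
  exact hyx (h1.symm.trans h2)

/-- A new triangle `abz` needs a common neighbour `z` of `a` and `b`. Every separating triangle
through `xy` separates `a` from `b`, so it must be `xyz`; this excludes a second one. -/
theorem not_mem_of_isSeparatingTriangle (hn : 6 ≤ Nat.card V)
    (hD : T.graph.IsSeparatingTriangle D) (hx : x ∈ D) (hy : y ∈ D)
    (hsafe : (∃ D', T.graph.IsSeparatingTriangle D' ∧ D' ≠ D ∧ x ∈ D' ∧ y ∈ D') ∨
      ∀ D', T.graph.IsSeparatingTriangle D' → D' ≠ D → ∀ p ∈ D, ∀ q ∈ D, p ≠ q →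
        ¬ (p ∈ D' ∧ q ∈ D'))
    (hE : T'.graph.IsSeparatingTriangle E) : ¬ (a ∈ E ∧ b ∈ E) := by
  rintro ⟨ha, hb⟩
  have h := P.flippable
  have h' := P.flippable'
  have hyE := T'.rot_notMem_of_isSeparatingTriangle hE ha hb h'.adj
  have hxE := T'.rot_notMem_of_isSeparatingTriangle hE hb ha h'.adj.symm
  rw [h'.left] at hyE
  rw [h'.right] at hxE
  have hEc := hE.1
  obtain ⟨z, hza, hzb, rfl⟩ := Finset.exists_eq_triple_of_mem hEc.card_eq ha hb h.ne
  have hzx : z ≠ x := by rintro rfl; simp at hxE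
  have hzy : z ≠ y := by rintro rfl; simp at hyE
  have haz : T.graph.Adj a z := P.adj' _ _ (hEc.isClique (by simp) (by simp) hza.symm) (by tauto)
  have hbz : T.graph.Adj b z := P.adj' _ _ (hEc.isClique (by simp) (by simp) hzb.symm) (by tauto)
  have hmem : ∀ D', T.graph.IsSeparatingTriangle D' → x ∈ D' → y ∈ D' →
      a ∉ D' ∧ b ∉ D' ∧ D' = {x, y, z} ∧ ¬ (T.graph.avoiding D').Reachable a b := by
    intro D' hD' hx' hy'
    have haD := T.rot_notMem_of_isSeparatingTriangle hD' hx' hy' h.adj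
    have hbD := T.rot_notMem_of_isSeparatingTriangle hD' hy' hx' h.adj.symm
    have hab := T.not_reachable_of_isSeparatingTriangle hD' hx' hy' h.adj
    rw [h.left] at haD hab
    rw [h.right] at hbD hab
    refine ⟨haD, hbD, ?_, hab⟩
    have hzD : z ∈ D' := by
      by_contra hzD
      exact hab (.trans (Adj.reachable ⟨haz, haD, hzD⟩) (Adj.reachable ⟨hbz.symm, hzD, hbD⟩))
    obtain ⟨t, -, -, rfl⟩ := Finset.exists_eq_triple_of_mem hD'.1.card_eq hx' hy' h.adj.ne
    have : z = t := by simpa [hzx, hzy] using hzD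
    rw [this]
  obtain ⟨haD, hbD, rfl, hab⟩ := hmem D hD hx hy
  obtain ⟨D', hD', hne, hx', hy'⟩ | hsafe := hsafe
  · exact hne (hmem D' hD' hx' hy').2.2.1
  have hxz : T.graph.Adj x z := hD.1.isClique (by simp) (by simp) hzx.symm
  have hyz : T.graph.Adj y z := hD.1.isClique (by simp) (by simp) hzy.symm
  -- Such a triangle shares the edge `pz` with `xyz`, so `hsafe` forbids it to separate.
  have hconn : ∀ c p : V, c ∉ ({x, y, z} : Finset V) → T.graph.Adj c p → T.graph.Adj c z →
      T.graph.Adj p z → p ∈ ({x, y, z} : Finset V) → T.graph.ConnectedOff {c, p, z} := by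
    intro c p hc hcp hcz hpz hp
    by_contra hcon
    refine hsafe {c, p, z} (T.isSeparatingTriangle_iff.2
      ⟨is3Clique_triple_iff.2 ⟨hcp, hcz, hpz⟩, hcon⟩) ?_ p hp z (by simp) hpz.ne (by simp)
    exact fun e => hc (e ▸ by simp)
  -- A sixth vertex provides a second vertex on the side of `a` or of `b`.
  obtain ⟨w, hw⟩ : ∃ w, w ∉ ({x, y, z, a, b} : Finset V) := by
    by_contra! hall
    have := Fintype.ofFinite V
    have h1 := Finset.card_le_card (fun v _ => hall v : Finset.univ ⊆ {x, y, z, a, b})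
    rw [Finset.card_univ, ← Nat.card_eq_fintype_card] at h1
    have := h1.trans Finset.card_le_five
    lia
  simp only [Finset.mem_insert, Finset.mem_singleton, not_or] at hw
  have hwD : w ∉ ({x, y, z} : Finset V) := by simp; tauto
  have hw' := T.reachable_of_notMem_triangle h.adj hzx hzy hwD
  have ha' := T.reachable_of_notMem_triangle h.adj hzx hzy haD
  rw [h.right] at hw' ha'
  have ha'' := ha'.resolve_left fun e => hab e.symm
  obtain hr | hr := hw'
  · rw [Finset.insert_comm] at hD hwD hr
    rw [Finset.insert_comm] at hE
    exact P.swap.not_isSeparatingTriangle_of_reachable hzy hzx hD hE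
      (hconn b y hbD h.adj_yb.symm hbz hyz (by simp))
      (hconn b x hbD h.adj_xb.symm hbz hxz (by simp)) hwD hw.2.2.2.2 hr.symm
  · exact P.not_isSeparatingTriangle_of_reachable hzx hzy hD hE
      (hconn a x haD h.adj_xa.symm haz hxz (by simp))
      (hconn a y haD h.adj_ya.symm haz hyz (by simp)) hwD hw.2.2.2.1 (hr.symm.trans ha'')

end FlipPair

/-- Flipping an edge `xy` of a separating triangle destroys the separating triangles through `xy`
and creates no new ones, provided that `xy` lies in several separating triangles or that the
triangle shares no edge with another separating triangle. -/
theorem exists_isFlip_of_isSeparatingTriangle [Finite V] [DecidableEq V] {D : Finset V}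
    (hn : 6 ≤ Nat.card V) (hD : T.graph.IsSeparatingTriangle D) (hx : x ∈ D) (hy : y ∈ D)
    (hxy : x ≠ y)
    (hsafe : (∃ D', T.graph.IsSeparatingTriangle D' ∧ D' ≠ D ∧ x ∈ D' ∧ y ∈ D') ∨
      ∀ D', T.graph.IsSeparatingTriangle D' → D' ≠ D → ∀ p ∈ D, ∀ q ∈ D, p ≠ q →
        ¬ (p ∈ D' ∧ q ∈ D')) :
    ∃ T' : Triangulation V, T.IsFlip T' ∧ ∀ E, T'.graph.IsSeparatingTriangle E ↔
      T.graph.IsSeparatingTriangle E ∧ ¬ (x ∈ E ∧ y ∈ E) := by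
  have : Nontrivial V := Finite.one_lt_card_iff_nontrivial.1 (by lia)
  have hadj : T.graph.Adj x y := hD.1.isClique hx hy hxy
  have ha := T.rot_notMem_of_isSeparatingTriangle hD hx hy hadj
  have hb := T.rot_notMem_of_isSeparatingTriangle hD hy hx hadj.symm
  have hab := T.not_reachable_of_isSeparatingTriangle hD hx hy hadj
  -- The apexes lie on different sides of `D`, hence are distinct and not adjacent.
  have h : T.Flippable x y (T.rot y x) (T.rot x y) :=
    ⟨hadj, rfl, rfl, fun e => hab (e ▸ .refl _), fun e => hab (Adj.reachable ⟨e, ha, hb⟩)⟩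
  obtain ⟨T', hflip, P⟩ := h.exists_flipPair
  refine ⟨T', hflip, fun E => ⟨fun hE => ⟨?_, ?_⟩, fun hE => P.isSeparatingTriangle hE.1 hE.2⟩⟩
  · exact P.symm.isSeparatingTriangle hE (P.not_mem_of_isSeparatingTriangle hn hD hx hy hsafe hE)
  · rintro ⟨hx', hy'⟩
    exact P.flippable'.not_adj (hE.1.isClique hy' hx' hxy.symm)

end Triangulation

/-! ### The potential of an abstract nesting -/

open scoped Classical in
/-- The members of `Δ` through `v` that are innermost among these. -/
noncomputable def minimalAt {V : Type*} (Δ : Finset (Finset V)) (R : Finset V → Finset V → Prop)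
    (v : V) : Finset (Finset V) :=
  Δ.filter fun D => v ∈ D ∧ ∀ D' ∈ Δ, v ∈ D' → ¬ R D' D

/-- The number of pairs of points contained in members of `Δ` plus the number of incidences of
points with innermost members of `Δ` through them. -/
noncomputable def nestingPotential {V : Type*} [Fintype V] [DecidableEq V] (Δ : Finset (Finset V))
    (R : Finset V → Finset V → Prop) : ℕ :=
  (Δ.biUnion (Finset.powersetCard 2)).card + ∑ v, (minimalAt Δ R v).card

/-- The laws satisfied by the nesting of the separating triangles of a triangulation. -/
structure IsNesting {V : Type*} (Δ : Finset (Finset V)) (R : Finset V → Finset V → Prop) :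
    Prop where
  card : ∀ D ∈ Δ, D.card = 3
  irrefl : ∀ D ∈ Δ, ¬ R D D
  trans : ∀ A ∈ Δ, ∀ B ∈ Δ, ∀ C ∈ Δ, R A B → R B C → R A C
  total : ∀ D ∈ Δ, ∀ A ∈ Δ, ∀ B ∈ Δ, R D A → R D B → A = B ∨ R A B ∨ R B A
  mem_of_mem : ∀ A ∈ Δ, ∀ B ∈ Δ, ∀ C ∈ Δ, R A B → R B C → ∀ v ∈ A, v ∈ C → v ∈ B
  rel_or_mem : ∀ A ∈ Δ, ∀ B ∈ Δ, ∀ C ∈ Δ, R A C → ∀ v ∈ A, v ∈ B → R B C ∨ v ∈ C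

namespace IsNesting

variable {V : Type*} {Δ Δ' : Finset (Finset V)} {R : Finset V → Finset V → Prop}
  {D D' : Finset V} {v x y z : V}

theorem mono (H : IsNesting Δ R) (h : Δ' ⊆ Δ) : IsNesting Δ' R where
  card D hD := H.card D (h hD)
  irrefl D hD := H.irrefl D (h hD)
  trans A hA B hB C hC := H.trans A (h hA) B (h hB) C (h hC)
  total D hD A hA B hB := H.total D (h hD) A (h hA) B (h hB)
  mem_of_mem A hA B hB C hC := H.mem_of_mem A (h hA) B (h hB) C (h hC)
  rel_or_mem A hA B hB C hC := H.rel_or_mem A (h hA) B (h hB) C (h hC)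

theorem mem_minimalAt :
    D ∈ minimalAt Δ R v ↔ D ∈ Δ ∧ v ∈ D ∧ ∀ D' ∈ Δ, v ∈ D' → ¬ R D' D := by
  simp [minimalAt]

theorem exists_minimalAt (H : IsNesting Δ R) (hD : D ∈ Δ) (hv : v ∈ D) :
    ∃ E ∈ minimalAt Δ R v, E = D ∨ R E D := by
  classical
  obtain ⟨E, hE, hmin⟩ := Finset.exists_min_image
    (Δ.filter fun E => v ∈ E ∧ (E = D ∨ R E D)) (fun E => (Δ.filter (R · E)).card)
    ⟨D, by simp [hD, hv]⟩
  simp only [Finset.mem_filter] at hE hmin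
  refine ⟨E, mem_minimalAt.2 ⟨hE.1, hE.2.1, fun F hF hvF hFE => ?_⟩, hE.2.2⟩
  refine (hmin F ⟨hF, hvF, .inr ?_⟩).not_gt (Finset.card_lt_card ?_)
  · obtain rfl | hED := hE.2.2
    · exact hFE
    · exact H.trans F hF E hE.1 D hD hFE hED
  · rw [Finset.ssubset_iff_of_subset]
    · exact ⟨F, by simp [hF, hFE], by simp [H.irrefl F hF]⟩
    · intro A hA
      simp only [Finset.mem_filter] at hA ⊢
      exact ⟨hA.1, H.trans A hA.1 F hF E hE.1 hA.2 hFE⟩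

/-- Send each innermost `C` of `Δ'` to an innermost `E` of `Δ` equal to it or inside it. This is
injective, since two sets around the same `E` are comparable, and it misses `W`. -/
theorem card_minimalAt_add_le (H : IsNesting Δ R) (hsub : Δ' ⊆ Δ) {W : Finset (Finset V)}
    (hW : W ⊆ minimalAt Δ R v)
    (h : ∀ C ∈ minimalAt Δ' R v, ∃ E ∈ minimalAt Δ R v, E ∉ W ∧ (E = C ∨ R E C)) :
    (minimalAt Δ' R v).card + W.card ≤ (minimalAt Δ R v).card := by
  classical
  choose! g hg hgW hgC using h
  have hinj : Set.InjOn g (minimalAt Δ' R v) := by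
    intro A hA B hB hAB
    have hgA := hgC A hA
    have hgB := hgC B hB
    have hE := (mem_minimalAt.1 (hg A hA)).1
    rw [Finset.mem_coe, mem_minimalAt] at hA hB
    rw [← hAB] at hgB
    obtain hgA | hgA := hgA <;> obtain hgB | hgB := hgB
    · exact hgA.symm.trans hgB
    · exact absurd (hgA ▸ hgB) (hB.2.2 A hA.1 hA.2.1)
    · exact absurd (hgB ▸ hgA) (hA.2.2 B hB.1 hB.2.1)
    · obtain h | h | h := H.total _ hE A (hsub hA.1) B (hsub hB.1) hgA hgB
      · exact h
      · exact absurd h (hB.2.2 A hA.1 hA.2.1)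
      · exact absurd h (hA.2.2 B hB.1 hB.2.1)
  rw [← Finset.card_image_of_injOn hinj, ← Finset.card_union_of_disjoint]
  · refine Finset.card_le_card (Finset.union_subset ?_ hW)
    intro E hE
    obtain ⟨C, hC, rfl⟩ := Finset.mem_image.1 hE
    exact hg C hC
  · rw [Finset.disjoint_left]
    intro E hE
    obtain ⟨C, hC, rfl⟩ := Finset.mem_image.1 hE
    exact hgW C hC

theorem card_minimalAt_le (H : IsNesting Δ R) (hsub : Δ' ⊆ Δ) :
    (minimalAt Δ' R v).card ≤ (minimalAt Δ R v).card := by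
  refine H.card_minimalAt_add_le hsub (Finset.empty_subset _) fun C hC => ?_
  have hC := mem_minimalAt.1 hC
  obtain ⟨E, hE, h⟩ := H.exists_minimalAt (hsub hC.1) hC.2.1
  exact ⟨E, hE, by simp, h⟩

theorem card_minimalAt_add_one_le (H : IsNesting Δ R) (hsub : Δ' ⊆ Δ) (hD : D ∈ Δ)
    (hD' : D ∉ Δ') (hmin : ∀ E ∈ Δ, ¬ R E D) (hv : v ∈ D)
    (h : ∀ C ∈ minimalAt Δ' R v, R D C → ∃ E ∈ minimalAt Δ R v, E ≠ D ∧ (E = C ∨ R E C)) :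
    (minimalAt Δ' R v).card + 1 ≤ (minimalAt Δ R v).card := by
  refine H.card_minimalAt_add_le (W := {D}) hsub ?_ fun C hC => ?_
  · rw [Finset.singleton_subset_iff, mem_minimalAt]
    exact ⟨hD, hv, fun E hE _ => hmin E hE⟩
  · have hC' := mem_minimalAt.1 hC
    obtain ⟨E, hE, hEC⟩ := H.exists_minimalAt (hsub hC'.1) hC'.2.1
    by_cases hED : E = D
    · obtain rfl | hEC := hEC
      · exact absurd (hED ▸ hC'.1) hD'
      · simpa using h C hC (hED ▸ hEC)
    · exact ⟨E, hE, by simpa, hEC⟩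

theorem card_minimalAt_add_one_le_of_notMem (H : IsNesting Δ R) (hsub : Δ' ⊆ Δ) (hD : D ∈ Δ)
    (hD' : D ∉ Δ') (hmin : ∀ E ∈ Δ, ¬ R E D) (hv : v ∈ D) (h : ∀ C ∈ Δ', R D C → v ∉ C) :
    (minimalAt Δ' R v).card + 1 ≤ (minimalAt Δ R v).card := by
  refine H.card_minimalAt_add_one_le hsub hD hD' hmin hv fun C hC hDC => ?_
  have hC := mem_minimalAt.1 hC
  exact absurd hC.2.1 (h C hC.1 hDC)

/-- The sets around `D` form a chain. If one contains `x` and one contains `y`, then by `mem_of_mem`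
the inner of the two contains both. -/
theorem notMem_or_notMem (H : IsNesting Δ R) (hsub : Δ' ⊆ Δ) (hD : D ∈ Δ) (hx : x ∈ D)
    (hy : y ∈ D) (h : ∀ C ∈ Δ', R D C → ¬ (x ∈ C ∧ y ∈ C)) :
    (∀ C ∈ Δ', R D C → x ∉ C) ∨ (∀ C ∈ Δ', R D C → y ∉ C) := by
  by_contra! hcon
  obtain ⟨⟨A, hA, hRA, hxA⟩, ⟨B, hB, hRB, hyB⟩⟩ := hcon
  obtain rfl | hAB | hAB := H.total _ hD A (hsub hA) B (hsub hB) hRA hRB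
  · exact h A hA hRA ⟨hxA, hyB⟩
  · exact h A hA hRA ⟨hxA, H.mem_of_mem _ hD A (hsub hA) B (hsub hB) hRA hAB y hy hyB⟩
  · exact h B hB hRB ⟨H.mem_of_mem _ hD B (hsub hB) A (hsub hA) hRB hAB x hx hxA, hyB⟩

variable [DecidableEq V]

theorem pair_mem_biUnion (hxy : x ≠ y) :
    {x, y} ∈ Δ.biUnion (Finset.powersetCard 2) ↔ ∃ D ∈ Δ, x ∈ D ∧ y ∈ D := by
  simp [Finset.mem_powersetCard, Finset.insert_subset_iff, Finset.card_pair hxy]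

theorem card_biUnion_add_le (hsub : Δ' ⊆ Δ) {W : Finset (Finset V)}
    (hW : W ⊆ Δ.biUnion (Finset.powersetCard 2))
    (hW' : ∀ e ∈ W, e ∉ Δ'.biUnion (Finset.powersetCard 2)) :
    (Δ'.biUnion (Finset.powersetCard 2)).card + W.card ≤
      (Δ.biUnion (Finset.powersetCard 2)).card := by
  rw [← Finset.card_union_of_disjoint (Finset.disjoint_right.2 hW')]
  exact Finset.card_le_card (Finset.union_subset (Finset.biUnion_subset_biUnion_of_subset_left _
    hsub) hW)

variable [Fintype V]

theorem nestingPotential_add_le {a i j k : ℕ}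
    (hE : (Δ'.biUnion (Finset.powersetCard 2)).card + a ≤
      (Δ.biUnion (Finset.powersetCard 2)).card)
    (hle : ∀ v, (minimalAt Δ' R v).card ≤ (minimalAt Δ R v).card)
    (hxy : x ≠ y) (hzx : z ≠ x) (hzy : z ≠ y)
    (hx : (minimalAt Δ' R x).card + i ≤ (minimalAt Δ R x).card)
    (hy : (minimalAt Δ' R y).card + j ≤ (minimalAt Δ R y).card)
    (hz : (minimalAt Δ' R z).card + k ≤ (minimalAt Δ R z).card) :
    nestingPotential Δ' R + (a + i + j + k) ≤ nestingPotential Δ R := by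
  have key : ∑ v, ((minimalAt Δ' R v).card + ((if v = x then i else 0) + (if v = y then j else 0) +
      (if v = z then k else 0))) ≤ ∑ v, (minimalAt Δ R v).card := by
    refine Finset.sum_le_sum fun v _ => ?_
    have := hle v
    split_ifs <;> subst_vars <;> first | contradiction | lia
  simp only [Finset.sum_add_distrib, Finset.sum_ite_eq', Finset.mem_univ, if_true] at key
  unfold nestingPotential
  lia

/-- All three edges of the triangle disappear, and so does one incidence at `z` and one at `x` or
`y`: `3 + 1 + 1`. -/
theorem nestingPotential_filter_add_five_le_of_private (H : IsNesting Δ R)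
    (hD : {x, y, z} ∈ Δ) (hxy : x ≠ y) (hzx : z ≠ x) (hzy : z ≠ y)
    (hmin : ∀ E ∈ Δ, ¬ R E {x, y, z}) (hz : ∀ C ∈ Δ, R {x, y, z} C → z ∉ C)
    (hxz : ∀ C ∈ Δ, C ≠ {x, y, z} → x ∈ C → z ∉ C)
    (hyz : ∀ C ∈ Δ, C ≠ {x, y, z} → y ∈ C → z ∉ C) :
    nestingPotential (Δ.filter fun E => ¬ (x ∈ E ∧ y ∈ E)) R + 5 ≤ nestingPotential Δ R := by
  set Δ' := Δ.filter fun E => ¬ (x ∈ E ∧ y ∈ E) with hΔ'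
  have hmem : ∀ C, C ∈ Δ' ↔ C ∈ Δ ∧ ¬ (x ∈ C ∧ y ∈ C) := by simp [hΔ']
  have hsub : Δ' ⊆ Δ := Finset.filter_subset _ _
  have hD' : {x, y, z} ∉ Δ' := by simp [hmem]
  have hE : (Δ'.biUnion (Finset.powersetCard 2)).card + 3 ≤
      (Δ.biUnion (Finset.powersetCard 2)).card := by
    have h3 : ({{x, y}, {x, z}, {y, z}} : Finset (Finset V)).card = 3 := by
      refine Finset.card_eq_three.2 ⟨_, _, _, ?_, ?_, ?_, rfl⟩
      · exact fun e => by simpa [hzx, hzy] using (Finset.ext_iff.1 e z)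
      · exact fun e => by simpa [hzx, hzy] using (Finset.ext_iff.1 e z)
      · exact fun e => by simpa [hxy, hzx.symm] using (Finset.ext_iff.1 e x)
    rw [← h3]
    refine card_biUnion_add_le hsub ?_ ?_
    · simp only [Finset.insert_subset_iff, Finset.singleton_subset_iff]
      exact ⟨(pair_mem_biUnion hxy).2 ⟨_, hD, by simp⟩,
        (pair_mem_biUnion hzx.symm).2 ⟨_, hD, by simp⟩,
        (pair_mem_biUnion hzy.symm).2 ⟨_, hD, by simp⟩⟩
    · simp only [Finset.mem_insert, Finset.mem_singleton]
      rintro e (rfl | rfl | rfl)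
      · rw [pair_mem_biUnion hxy]
        rintro ⟨C, hC, h⟩
        exact ((hmem C).1 hC).2 h
      · rw [pair_mem_biUnion hzx.symm]
        rintro ⟨C, hC, h⟩
        exact hxz C (hsub hC) (fun e => hD' (e ▸ hC)) h.1 h.2
      · rw [pair_mem_biUnion hzy.symm]
        rintro ⟨C, hC, h⟩
        exact hyz C (hsub hC) (fun e => hD' (e ▸ hC)) h.1 h.2
  have hle := fun v => H.card_minimalAt_le (v := v) hsub
  have h1 := H.card_minimalAt_add_one_le_of_notMem (v := z) hsub hD hD' hmin (by simp)
    fun C hC => hz C (hsub hC)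
  have h2 := H.notMem_or_notMem hsub hD (x := x) (y := y) (by simp) (by simp)
    fun C hC _ => ((hmem C).1 hC).2
  obtain h2 | h2 := h2
  · exact nestingPotential_add_le (j := 0) hE hle hxy hzx hzy
      (H.card_minimalAt_add_one_le_of_notMem hsub hD hD' hmin (by simp) h2) (hle y) h1
  · exact nestingPotential_add_le (i := 0) hE hle hxy hzx hzy (hle x)
      (H.card_minimalAt_add_one_le_of_notMem hsub hD hD' hmin (by simp) h2) h1

/-- The edge `xy`, one incidence at `x` and two at `y` are lost. The fifth unit is the edge `yz` or,
if that survives, an incidence at `z`. -/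
theorem nestingPotential_filter_add_five_le_of_shared (H : IsNesting Δ R)
    (hD : {x, y, z} ∈ Δ) (hxy : x ≠ y) (hzx : z ≠ x) (hzy : z ≠ y)
    (hmin : ∀ E ∈ Δ, ¬ R E {x, y, z}) (hD' : D' ∈ Δ) (hne : D' ≠ {x, y, z}) (hx : x ∈ D')
    (hy : y ∈ D') (hmin' : ∀ E ∈ Δ, ¬ R E D') (hup : ∀ C ∈ Δ, R D' C → R {x, y, z} C)
    (hyC : ∀ C ∈ Δ, R {x, y, z} C → y ∉ C) :
    nestingPotential (Δ.filter fun E => ¬ (x ∈ E ∧ y ∈ E)) R + 5 ≤ nestingPotential Δ R := by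
  set Δ' := Δ.filter fun E => ¬ (x ∈ E ∧ y ∈ E) with hΔ'
  have hmem : ∀ C, C ∈ Δ' ↔ C ∈ Δ ∧ ¬ (x ∈ C ∧ y ∈ C) := by simp [hΔ']
  have hsub : Δ' ⊆ Δ := Finset.filter_subset _ _
  have hDn : {x, y, z} ∉ Δ' := by simp [hmem]
  have hDn' : D' ∉ Δ' := by simp [hmem, hx, hy]
  have hle := fun v => H.card_minimalAt_le (v := v) hsub
  have h1 : (minimalAt Δ' R x).card + 1 ≤ (minimalAt Δ R x).card := by
    refine H.card_minimalAt_add_one_le hsub hD' hDn' hmin' hx fun C hC hDC => ?_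
    refine ⟨_, mem_minimalAt.2 ⟨hD, by simp, fun E hE _ => hmin E hE⟩, hne.symm, .inr ?_⟩
    exact hup C (hsub (mem_minimalAt.1 hC).1) hDC
  have h2 : (minimalAt Δ' R y).card + 2 ≤ (minimalAt Δ R y).card := by
    rw [← Finset.card_pair hne]
    refine H.card_minimalAt_add_le hsub ?_ fun C hC => ?_
    · simp only [Finset.insert_subset_iff, Finset.singleton_subset_iff, mem_minimalAt]
      exact ⟨⟨hD', hy, fun E hE _ => hmin' E hE⟩, hD, by simp, fun E hE _ => hmin E hE⟩
    · have hC := mem_minimalAt.1 hC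
      obtain ⟨E, hE, hEC⟩ := H.exists_minimalAt (hsub hC.1) hC.2.1
      refine ⟨E, hE, ?_, hEC⟩
      simp only [Finset.mem_insert, Finset.mem_singleton, not_or]
      constructor
      · rintro rfl
        obtain rfl | hEC := hEC
        · exact hDn' hC.1
        · exact hyC C (hsub hC.1) (hup C (hsub hC.1) hEC) hC.2.1
      · rintro rfl
        obtain rfl | hEC := hEC
        · exact hDn hC.1
        · exact hyC C (hsub hC.1) hEC hC.2.1
  have hxyΔ : {x, y} ∈ Δ.biUnion (Finset.powersetCard 2) :=
    (pair_mem_biUnion hxy).2 ⟨_, hD, by simp⟩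
  have hxyΔ' : {x, y} ∉ Δ'.biUnion (Finset.powersetCard 2) := by
    rw [pair_mem_biUnion hxy]
    rintro ⟨C, hC, h⟩
    exact ((hmem C).1 hC).2 h
  by_cases hyz : ∃ E ∈ Δ', y ∈ E ∧ z ∈ E
  · obtain ⟨E, hE, hyE, hzE⟩ := hyz
    have h3 : (minimalAt Δ' R z).card + 1 ≤ (minimalAt Δ R z).card := by
      refine H.card_minimalAt_add_one_le hsub hD hDn hmin (by simp) fun C hC hDC => ?_
      have hC := mem_minimalAt.1 hC
      have := (H.rel_or_mem _ hD E (hsub hE) C (hsub hC.1) hDC y (by simp) hyE).resolve_right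
        (hyC C (hsub hC.1) hDC)
      -- The surviving `E` through `yz` lies inside any `C` around the triangle, as `y ∉ C`; so such
      -- a `C` is not innermost at `z`.
      exact absurd this (hC.2.2 E hE hzE)
    refine nestingPotential_add_le (a := 1) ?_ hle hxy hzx hzy h1 h2 h3
    exact card_biUnion_add_le (W := {{x, y}}) hsub (by simpa using hxyΔ) (by simpa using hxyΔ')
  · refine nestingPotential_add_le (a := 2) (k := 0) ?_ hle hxy hzx hzy h1 h2 (hle z)
    have hpair : ({x, y} : Finset V) ≠ {y, z} := fun e => by
      simpa [hxy, hzx.symm] using Finset.ext_iff.1 e x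
    have hle' := card_biUnion_add_le (W := {{x, y}, {y, z}}) hsub ?_ ?_
    · rwa [Finset.card_pair hpair] at hle'
    · simp only [Finset.insert_subset_iff, Finset.singleton_subset_iff]
      exact ⟨hxyΔ, (pair_mem_biUnion hzy.symm).2 ⟨_, hD, by simp⟩⟩
    · simp only [Finset.mem_insert, Finset.mem_singleton]
      rintro e (rfl | rfl)
      · exact hxyΔ'
      · rwa [pair_mem_biUnion hzy.symm]

/-- As long as there are separating triangles, one of their edges can be flipped to decrease the
potential by at least `5`. -/
theorem exists_nestingPotential_add_five_le (H : IsNesting Δ R) (hΔ : Δ.Nonempty) :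
    ∃ D ∈ Δ, ∃ x ∈ D, ∃ y ∈ D, x ≠ y ∧
      ((∃ D' ∈ Δ, D' ≠ D ∧ x ∈ D' ∧ y ∈ D') ∨
        ∀ D' ∈ Δ, D' ≠ D → ∀ p ∈ D, ∀ q ∈ D, p ≠ q → ¬ (p ∈ D' ∧ q ∈ D')) ∧
      nestingPotential (Δ.filter fun E => ¬ (x ∈ E ∧ y ∈ E)) R + 5 ≤ nestingPotential Δ R := by
  classical
  let depth (D : Finset V) : ℕ := (Δ.filter (R D ·)).card
  have depth_lt : ∀ E ∈ Δ, ∀ F ∈ Δ, R E F → depth F < depth E := by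
    intro E hE F hF hEF
    refine Finset.card_lt_card ((Finset.ssubset_iff_of_subset ?_).2
      ⟨F, by simp [hF, hEF], by simp [H.irrefl F hF]⟩)
    intro A hA
    simp only [Finset.mem_filter] at hA ⊢
    exact ⟨hA.1, H.trans E hE F hF A hA.1 hEF hA.2⟩
  obtain ⟨D, hD, hmax⟩ := Finset.exists_max_image Δ depth hΔ
  have hmin_of : ∀ E ∈ Δ, depth D ≤ depth E → ∀ F ∈ Δ, ¬ R F E := fun E hE hDE F hF hFE =>
    (depth_lt F hF E hE hFE).not_ge ((hmax F hF).trans hDE)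
  have hmin := hmin_of D hD le_rfl
  by_cases hsh : ∃ x ∈ D, ∃ y ∈ D, x ≠ y ∧ (∃ D' ∈ Δ, D' ≠ D ∧ x ∈ D' ∧ y ∈ D') ∧
      ∀ C ∈ Δ, R D C → ¬ (x ∈ C ∧ y ∈ C)
  · obtain ⟨x, hx, y, hy, hxy, ⟨D₀, hD₀⟩, hC⟩ := hsh
    -- With `D'` outermost among the other triangles through `xy`, nothing around `D'` contains
    -- `xy`. Then `D` and `D'` have the same surroundings, so `D'` is also deepest and has nothing
    -- inside.
    obtain ⟨D', hD', hDmin⟩ := Finset.exists_min_image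
      (Δ.filter fun E => E ≠ D ∧ x ∈ E ∧ y ∈ E) depth ⟨D₀, by simpa using hD₀⟩
    simp only [Finset.mem_filter] at hD' hDmin
    obtain ⟨hD', hne, hx', hy'⟩ := hD'
    have hC' : ∀ C ∈ Δ, R D' C → ¬ (x ∈ C ∧ y ∈ C) := by
      intro C hC hDC h
      refine (depth_lt D' hD' C hC hDC).not_ge (hDmin C ⟨hC, ?_, h⟩)
      rintro rfl
      exact hmin D' hD' hDC
    have hup : ∀ A ∈ Δ, ∀ B ∈ Δ, x ∈ A → y ∈ A → x ∈ B → y ∈ B → ∀ C ∈ Δ,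
        ¬ (x ∈ C ∧ y ∈ C) → R A C → R B C := by
      intro A hA B hB hxA hyA hxB hyB C hC hn hAC
      by_contra hBC
      exact hn ⟨(H.rel_or_mem A hA B hB C hC hAC x hxA hxB).resolve_left hBC,
        (H.rel_or_mem A hA B hB C hC hAC y hyA hyB).resolve_left hBC⟩
    have hup' : ∀ C ∈ Δ, R D' C → R D C := fun C hCΔ h =>
      hup D' hD' D hD hx' hy' hx hy C hCΔ (hC' C hCΔ h) h
    have hmin' : ∀ E ∈ Δ, ¬ R E D' := by
      refine hmin_of D' hD' (Finset.card_le_card fun C => ?_)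
      simp only [Finset.mem_filter]
      exact fun ⟨hCΔ, h⟩ => ⟨hCΔ, hup D hD D' hD' hx hy hx' hy' C hCΔ (hC C hCΔ h) h⟩
    obtain hyC | hyC := (H.notMem_or_notMem subset_rfl hD hx hy hC).symm
    · refine ⟨D, hD, x, hx, y, hy, hxy, .inl ⟨D', hD', hne, hx', hy'⟩, ?_⟩
      obtain ⟨z, hzx, hzy, rfl⟩ := Finset.exists_eq_triple_of_mem (H.card D hD) hx hy hxy
      exact H.nestingPotential_filter_add_five_le_of_shared hD hxy hzx hzy hmin hD' hne hx' hy'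
        hmin' hup' hyC
    · refine ⟨D, hD, y, hy, x, hx, hxy.symm, .inl ⟨D', hD', hne, hy', hx'⟩, ?_⟩
      obtain ⟨z, hzy, hzx, rfl⟩ := Finset.exists_eq_triple_of_mem (H.card D hD) hy hx hxy.symm
      exact H.nestingPotential_filter_add_five_le_of_shared hD hxy.symm hzy hzx hmin hD' hne hy'
        hx' hmin' hup' hyC
  -- From here on, every edge that `D` shares with another triangle also lies in a triangle around
  -- `D`.
  push Not at hsh
  by_cases hup : ∃ x ∈ D, ∃ y ∈ D, x ≠ y ∧ ∃ C ∈ Δ, R D C ∧ x ∈ C ∧ y ∈ C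
  · obtain ⟨x, hx, y, hy, hxy, C, hC, hDC, hxC, hyC⟩ := hup
    have hne : C ≠ D := fun e => hmin D hD (e ▸ hDC)
    refine ⟨D, hD, x, hx, y, hy, hxy, .inl ⟨C, hC, hne, hxC, hyC⟩, ?_⟩
    obtain ⟨z, hzx, hzy, rfl⟩ := Finset.exists_eq_triple_of_mem (H.card D hD) hx hy hxy
    have heq : ∀ E ∈ Δ, x ∈ E → y ∈ E → z ∈ E → {x, y, z} = E := fun E hE h1 h2 h3 =>
      Finset.eq_of_subset_of_card_le (by simp [Finset.insert_subset_iff, *])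
        (by rw [H.card _ hD, H.card _ hE])
    -- Otherwise the inner of `C` and `E` would contain all of `x`, `y`, `z` and so equal `D`.
    have hz : ∀ E ∈ Δ, R {x, y, z} E → z ∉ E := by
      intro E hE hDE hzE
      obtain rfl | h | h := H.total _ hD C hC E hE hDC hDE
      · exact hne (heq C hC hxC hyC hzE).symm
      · exact hne (heq C hC hxC hyC
          (H.mem_of_mem _ hD C hC E hE hDC h z (by simp) hzE)).symm
      · have := heq E hE (H.mem_of_mem _ hD E hE C hC hDE h x (by simp) hxC)
          (H.mem_of_mem _ hD E hE C hC hDE h y (by simp) hyC) hzE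
        exact hmin _ hD (this ▸ hDE)
    refine H.nestingPotential_filter_add_five_le_of_private hD hxy hzx hzy hmin hz ?_ ?_
    · intro E hE hED hxE hzE
      obtain ⟨F, hF, hDF, -, hzF⟩ := hsh x (by simp) z (by simp) hzx.symm ⟨E, hE, hED, hxE, hzE⟩
      exact hz F hF hDF hzF
    · intro E hE hED hyE hzE
      obtain ⟨F, hF, hDF, -, hzF⟩ := hsh y (by simp) z (by simp) hzy.symm ⟨E, hE, hED, hyE, hzE⟩
      exact hz F hF hDF hzF
  · push Not at hup
    have hpriv : ∀ D' ∈ Δ, D' ≠ D → ∀ p ∈ D, ∀ q ∈ D, p ≠ q → ¬ (p ∈ D' ∧ q ∈ D') := by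
      rintro E hE hED p hp q hq hpq ⟨hpE, hqE⟩
      obtain ⟨F, hF, hDF, hpF, hqF⟩ := hsh p hp q hq hpq ⟨E, hE, hED, hpE, hqE⟩
      exact hup p hp q hq hpq F hF hDF hpF hqF
    obtain ⟨z, hz, hzC⟩ : ∃ z ∈ D, ∀ C ∈ Δ, R D C → z ∉ C := by
      obtain ⟨x, hx, y, hy, hxy⟩ := Finset.one_lt_card.1 (by rw [H.card D hD]; lia : 1 < D.card)
      obtain h | h := H.notMem_or_notMem subset_rfl hD hx hy
        fun C hC hDC hxyC => hup x hx y hy hxy C hC hDC hxyC.1 hxyC.2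
      · exact ⟨x, hx, h⟩
      · exact ⟨y, hy, h⟩
    obtain ⟨x, hx, hxz⟩ := Finset.exists_mem_ne (by rw [H.card D hD]; lia) z
    obtain ⟨y, hyx, hyz, rfl⟩ := Finset.exists_eq_triple_of_mem (H.card D hD) hx hz hxz
    refine ⟨_, hD, x, by simp, y, by simp, hyx.symm, .inr hpriv, ?_⟩
    have hcomm : ({x, z, y} : Finset V) = {x, y, z} := by rw [Finset.pair_comm]
    rw [hcomm] at hD hmin hzC hpriv
    exact H.nestingPotential_filter_add_five_le_of_private hD hyx.symm hxz.symm hyz.symm hmin hzC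
      (fun E hE hED hxE hzE => hpriv E hE hED x (by simp) z (by simp) hxz ⟨hxE, hzE⟩)
      (fun E hE hED hyE hzE => hpriv E hE hED y (by simp) z (by simp) hyz ⟨hyE, hzE⟩)

end IsNesting

/-! ### The nesting of separating triangles -/

namespace Triangulation

open SimpleGraph

variable {V : Type*} (T : Triangulation V) {o D D' A B : Finset V} {r t u v w : V}

/-- The vertices separated by `D` from the root triangle `o`. -/
def inner (o D : Finset V) : Set V :=
  {w | w ∉ D ∧ ∀ r ∈ o, r ∉ D → ¬ (T.graph.avoiding D).Reachable r w}

/-- `D'` meets the side of `D` that is not the side of the root triangle `o`. -/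
def Nested (o D' D : Finset V) : Prop :=
  ∃ v ∈ D', v ∈ T.inner o D

variable {T}

theorem mem_inner_of_reachable (hu : u ∈ T.inner o D) (h : (T.graph.avoiding D).Reachable u w) :
    w ∈ T.inner o D :=
  ⟨h.notMem_of_avoiding hu.1, fun r hr hrD hrw => hu.2 r hr hrD (hrw.trans h.symm)⟩

theorem mem_or_mem_inner (hD' : T.graph.IsClique D') (h : T.Nested o D' D) (hv : v ∈ D') :
    v ∈ D ∨ v ∈ T.inner o D := by
  obtain ⟨u, hu, huD⟩ := h
  by_cases huv : u = v
  · exact .inr (huv ▸ huD)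
  · refine or_iff_not_imp_left.2 fun hvD => ?_
    exact mem_inner_of_reachable huD (Adj.reachable ⟨hD' hu hv huv, huD.1, hvD⟩)

/-- A clique with a vertex inside `D` has no vertex on the root side of `D`, so walks there survive
its deletion. -/
theorem reachable_of_nested (hD' : T.graph.IsClique D') (h : T.Nested o D' D) (hr : r ∈ o)
    (hrD : r ∉ D) (ht : (T.graph.avoiding D).Reachable r t) :
    t ∉ D' ∧ (T.graph.avoiding D').Reachable r t := by
  have key : ∀ s, (T.graph.avoiding D).Reachable r s → s ∉ D' := fun s hs hsD' =>
    (mem_or_mem_inner hD' h hsD').elim (hs.notMem_of_avoiding hrD) fun hin => hin.2 r hr hrD hs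
  refine ⟨key t ht, (ht.rec_adj (P := fun s => (T.graph.avoiding D).Reachable r s ∧
    (T.graph.avoiding D').Reachable r s) ⟨.refl _, .refl _⟩ ?_).2⟩
  rintro a b ⟨ha, ha'⟩ hab
  have hb := ha.trans (Adj.reachable hab)
  exact ⟨hb, ha'.trans (Adj.reachable ⟨hab.1, key a ha, key b hb⟩)⟩

theorem exists_root (ho : T.graph.IsNClique 3 o) (hoc : ¬ T.graph.IsSeparatingTriangle o)
    (hD : T.graph.IsSeparatingTriangle D) : ∃ r ∈ o, r ∉ D := by
  by_contra! hsub
  have := Finset.eq_of_subset_of_card_le hsub (by rw [ho.card_eq, hD.1.card_eq])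
  exact hoc (this ▸ hD)

theorem inner_nonempty (ho : T.graph.IsNClique 3 o) (hoc : ¬ T.graph.IsSeparatingTriangle o)
    (hD : T.graph.IsSeparatingTriangle D) : (T.inner o D).Nonempty := by
  obtain ⟨r, hr, hrD⟩ := exists_root ho hoc hD
  obtain ⟨w, hwD, hrw⟩ : ∃ w, w ∉ D ∧ ¬ (T.graph.avoiding D).Reachable r w := by
    by_contra! hall
    exact (T.isSeparatingTriangle_iff.1 hD).2 fun u w hu hw => (hall u hu).symm.trans (hall w hw)
  refine ⟨w, hwD, fun s hs hsD hsw => ?_⟩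
  by_cases hrs : r = s
  · exact hrw (hrs ▸ hsw)
  · exact hrw (.trans (Adj.reachable ⟨ho.isClique hr hs hrs, hrD, hsD⟩) hsw)

variable [Finite V] [DecidableEq V] [Nontrivial V]

theorem inner_subset_inner (ho : T.graph.IsNClique 3 o)
    (hoc : ¬ T.graph.IsSeparatingTriangle o) (hD : T.graph.IsSeparatingTriangle D)
    (hD' : T.graph.IsClique D') (h : T.Nested o D' D) : T.inner o D' ⊆ T.inner o D := by
  intro w hw
  refine ⟨fun hwD => ?_, fun r hr hrD hrw => ?_⟩
  · obtain ⟨r, hr, hrD⟩ := exists_root ho hoc hD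
    obtain ⟨t, hwt, htD, hrt⟩ := T.exists_adj_reachable hD.1.card_eq hwD hrD
    obtain ⟨htD', hrt'⟩ := reachable_of_nested hD' h hr hrD hrt
    exact hw.2 r hr (reachable_of_nested hD' h hr hrD (.refl _)).1
      (hrt'.trans (Adj.reachable ⟨hwt.symm, htD', hw.1⟩))
  · exact hw.2 r hr (reachable_of_nested hD' h hr hrD (.refl _)).1
      (reachable_of_nested hD' h hr hrD hrw).2

theorem exists_adj_mem_inner (ho : T.graph.IsNClique 3 o)
    (hoc : ¬ T.graph.IsSeparatingTriangle o) (hD : T.graph.IsSeparatingTriangle D)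
    (hv : v ∈ D) : ∃ t, T.graph.Adj v t ∧ t ∈ T.inner o D := by
  obtain ⟨w, hw⟩ := inner_nonempty ho hoc hD
  obtain ⟨t, ht, -, hwt⟩ := T.exists_adj_reachable hD.1.card_eq hv hw.1
  exact ⟨t, ht, mem_inner_of_reachable hw hwt⟩

/-- There are at most two components off `D`, and the root occupies one of them. -/
theorem reachable_of_mem_inner (ho : T.graph.IsNClique 3 o)
    (hoc : ¬ T.graph.IsSeparatingTriangle o) (hD : T.graph.IsSeparatingTriangle D)
    (hu : u ∈ T.inner o D) (hw : w ∈ T.inner o D) : (T.graph.avoiding D).Reachable u w := by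
  obtain ⟨r, hr, hrD⟩ := exists_root ho hoc hD
  have hru := hu.2 r hr hrD
  have hrw := hw.2 r hr hrD
  have huD := hu.1
  have hwD := hw.1
  obtain ⟨x, y, z, hxy, hxz, hyz, rfl⟩ := Finset.card_eq_three.1 hD.1.card_eq
  have hadj : T.graph.Adj x y := hD.1.isClique (by simp) (by simp) hxy
  have h1 := T.reachable_of_notMem_triangle hadj hxz.symm hyz.symm huD
  have h2 := T.reachable_of_notMem_triangle hadj hxz.symm hyz.symm hwD
  have h3 := T.reachable_of_notMem_triangle hadj hxz.symm hyz.symm hrD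
  obtain h1 | h1 := h1 <;> obtain h2 | h2 := h2
  · exact h1.symm.trans h2
  · obtain h3 | h3 := h3
    · exact absurd (h3.symm.trans h1) hru
    · exact absurd (h3.symm.trans h2) hrw
  · obtain h3 | h3 := h3
    · exact absurd (h3.symm.trans h2) hrw
    · exact absurd (h3.symm.trans h1) hru
  · exact h1.symm.trans h2

/-- If no vertex of `B` is inside `A`, the connected inside of `A` lies inside `B`. Each vertex of
`A` has a neighbour there, so it belongs to `B` or is inside `B`. -/
theorem eq_or_nested_of_mem_inner (ho : T.graph.IsNClique 3 o)
    (hoc : ¬ T.graph.IsSeparatingTriangle o) (hA : T.graph.IsSeparatingTriangle A)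
    (hB : T.graph.IsSeparatingTriangle B) (hwA : w ∈ T.inner o A) (hwB : w ∈ T.inner o B) :
    A = B ∨ T.Nested o A B ∨ T.Nested o B A := by
  by_contra! hcon
  obtain ⟨hne, hAB, hBA⟩ := hcon
  refine hne (Finset.eq_of_subset_of_card_le (fun u hu => ?_)
    (by rw [hA.1.card_eq, hB.1.card_eq]))
  obtain ⟨t, hut, ht⟩ := exists_adj_mem_inner ho hoc hA hu
  have hwt := reachable_of_mem_inner ho hoc hA hwA ht
  have htB : t ∈ T.inner o A ∧ t ∈ T.inner o B := by
    refine hwt.rec_adj (P := fun t => t ∈ T.inner o A ∧ t ∈ T.inner o B) ⟨hwA, hwB⟩ ?_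
    rintro a b ⟨ha, ha'⟩ hab
    have hb := mem_inner_of_reachable ha hab.reachable
    exact ⟨hb, mem_inner_of_reachable ha'
      (Adj.reachable ⟨hab.1, ha'.1, fun hbB => hBA ⟨b, hbB, hb⟩⟩)⟩
  by_contra huB
  exact hAB ⟨u, hu, mem_inner_of_reachable htB.2 (Adj.reachable ⟨hut.symm, htB.2.1, huB⟩)⟩

theorem isNesting (ho : T.graph.IsNClique 3 o) (hoc : ¬ T.graph.IsSeparatingTriangle o)
    {Δ : Finset (Finset V)} (hΔ : ∀ D ∈ Δ, T.graph.IsSeparatingTriangle D) :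
    IsNesting Δ (T.Nested o) where
  card D hD := (hΔ D hD).1.card_eq
  irrefl D _ := fun ⟨_, hv, hv'⟩ => hv'.1 hv
  trans A _ B hB C hC := fun ⟨v, hv, hv'⟩ hBC =>
    ⟨v, hv, inner_subset_inner ho hoc (hΔ C hC) (hΔ B hB).1.isClique hBC hv'⟩
  total D hD A hA B hB hDA hDB := by
    obtain ⟨w, hw⟩ := inner_nonempty ho hoc (hΔ D hD)
    exact eq_or_nested_of_mem_inner ho hoc (hΔ A hA) (hΔ B hB)
      (inner_subset_inner ho hoc (hΔ A hA) (hΔ D hD).1.isClique hDA hw)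
      (inner_subset_inner ho hoc (hΔ B hB) (hΔ D hD).1.isClique hDB hw)
  mem_of_mem A hA B hB C hC hAB hBC v hvA hvC :=
    (mem_or_mem_inner (hΔ A hA).1.isClique hAB hvA).resolve_right fun h =>
      (inner_subset_inner ho hoc (hΔ C hC) (hΔ B hB).1.isClique hBC h).1 hvC
  rel_or_mem A hA B _ C _ hAC v hvA hvB :=
    (mem_or_mem_inner (hΔ A hA).1.isClique hAC hvA).symm.imp_left fun h => ⟨v, hvB, h⟩

omit [DecidableEq V] [Nontrivial V] in
theorem card_edgeSet_add_six : Nat.card T.graph.edgeSet + 6 = 3 * Nat.card V := by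
  have h1 := RotationSystem.three_mul_card_face T.face_length
  have h2 := T.euler
  lia

theorem nestingPotential_le [Fintype V] (ho : T.graph.IsNClique 3 o)
    (hoc : ¬ T.graph.IsSeparatingTriangle o) {Δ : Finset (Finset V)}
    (hΔ : ∀ D ∈ Δ, T.graph.IsSeparatingTriangle D) :
    nestingPotential Δ (T.Nested o) ≤ Nat.card T.graph.edgeSet := by
  classical
  have H := isNesting ho hoc hΔ
  have hex : ∀ v, ∀ D ∈ minimalAt Δ (T.Nested o) v, ∃ t, T.graph.Adj v t ∧ t ∈ T.inner o D :=
    fun v D hD => by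
      have hD := IsNesting.mem_minimalAt.1 hD
      exact exists_adj_mem_inner ho hoc (hΔ D hD.1) hD.2.1
  choose! t ht ht' using hex
  let I : Finset (Σ _ : V, Finset V) := Finset.univ.sigma (minimalAt Δ (T.Nested o))
  let f : (Σ _ : V, Finset V) → Finset V := fun p => {p.1, t p.1 p.2}
  have hI : ∀ p ∈ I, p.2 ∈ Δ ∧ p.1 ∈ p.2 ∧ (∀ D' ∈ Δ, p.1 ∈ D' → ¬ T.Nested o D' p.2) ∧
      T.graph.Adj p.1 (t p.1 p.2) ∧ t p.1 p.2 ∈ T.inner o p.2 := by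
    intro p hp
    have hp := (Finset.mem_sigma.1 hp).2
    obtain ⟨h1, h2, h3⟩ := IsNesting.mem_minimalAt.1 hp
    exact ⟨h1, h2, h3, ht _ _ hp, ht' _ _ hp⟩
  have hinj : Set.InjOn f I := by
    rintro ⟨v, D⟩ hp ⟨v', D'⟩ hp' he
    obtain ⟨h1, h2, h3, h4, h5⟩ := hI _ hp
    obtain ⟨h1', h2', h3', h4', h5'⟩ := hI _ hp'
    simp only [f] at h1 h2 h3 h4 h5 h1' h2' h3' h4' h5' he
    have hs : s(v, t v D) = s(v', t v' D') :=
      Sym2.ext fun c => by simpa using Finset.ext_iff.1 he c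
    -- An edge charged twice from the same end gives two comparable innermost triangles there;
    -- charged from both ends, it gives two triangles nested in each other.
    obtain ⟨rfl, hte⟩ | ⟨hv, hv'⟩ := Sym2.eq_iff.1 hs
    · obtain rfl | h | h := eq_or_nested_of_mem_inner ho hoc (hΔ D h1) (hΔ D' h1') h5 (hte ▸ h5')
      · rfl
      · exact absurd h (h3' D h1 h2)
      · exact absurd h (h3 D' h1' h2')
    · exact absurd (H.trans D h1 D' h1' D h1 ⟨v, h2, hv ▸ h5'⟩ ⟨v', h2', hv' ▸ h5⟩)
        (H.irrefl D h1)
  have hdisj : Disjoint (Δ.biUnion (Finset.powersetCard 2)) (I.image f) := by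
    rw [Finset.disjoint_right]
    intro e he
    obtain ⟨p, hp, rfl⟩ := Finset.mem_image.1 he
    obtain ⟨-, -, h3, h4, h5⟩ := hI p hp
    rw [IsNesting.pair_mem_biUnion h4.ne]
    rintro ⟨E, hE, h1, h2⟩
    -- A separating triangle through the charged edge would pass through the same vertex and be
    -- nested in the innermost one.
    exact h3 E hE h1 ⟨_, h2, h5⟩
  have hsub : Δ.biUnion (Finset.powersetCard 2) ∪ I.image f ⊆
      T.graph.edgeFinset.image Sym2.toFinset := by
    have hpair : ∀ x y, T.graph.Adj x y →
        {x, y} ∈ T.graph.edgeFinset.image Sym2.toFinset := fun x y h =>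
      Finset.mem_image.2 ⟨s(x, y), by simpa using h, Sym2.toFinset_mk_eq⟩
    intro e he
    obtain he | he := Finset.mem_union.1 he
    · obtain ⟨D, hD, he⟩ := Finset.mem_biUnion.1 he
      obtain ⟨hsub, hcard⟩ := Finset.mem_powersetCard.1 he
      obtain ⟨x, y, hxy, rfl⟩ := Finset.card_eq_two.1 hcard
      exact hpair x y ((hΔ D hD).1.isClique (hsub (by simp)) (hsub (by simp)) hxy)
    · obtain ⟨p, hp, rfl⟩ := Finset.mem_image.1 he
      exact hpair _ _ (hI p hp).2.2.2.1
  have h1 := (Finset.card_le_card hsub).trans Finset.card_image_le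
  rw [Finset.card_union_of_disjoint hdisj, Finset.card_image_of_injOn hinj,
    Finset.card_sigma] at h1
  rwa [Nat.card_eq_fintype_card, ← edgeFinset_card]

-- The relation `R` is never recomputed: flips only remove separating triangles, and the nesting
-- laws pass to subfamilies.
omit [Nontrivial V] in
theorem exists_isFlip_sequence [Fintype V] (hn : 6 ≤ Nat.card V)
    {R : Finset V → Finset V → Prop} (m : ℕ) (T : Triangulation V) (Δ : Finset (Finset V))
    (hΔ : ∀ D, D ∈ Δ ↔ T.graph.IsSeparatingTriangle D) (H : IsNesting Δ R)
    (hm : nestingPotential Δ R ≤ m) :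
    ∃ k, 5 * k ≤ m ∧ ∃ S : ℕ → Triangulation V, S 0 = T ∧ (∀ i < k, (S i).IsFlip (S (i + 1))) ∧
      ∀ D, ¬ (S k).graph.IsSeparatingTriangle D := by
  induction m using Nat.strong_induction_on generalizing T Δ with
  | _ m ih =>
  obtain rfl | hne := Δ.eq_empty_or_nonempty
  · exact ⟨0, by simp, fun _ => T, rfl, by simp, fun D hD => by simpa using (hΔ D).2 hD⟩
  obtain ⟨D, hD, x, hx, y, hy, hxy, hsafe, hpot⟩ := H.exists_nestingPotential_add_five_le hne
  simp only [hΔ] at hsafe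
  obtain ⟨T', hflip, hT'⟩ := T.exists_isFlip_of_isSeparatingTriangle hn ((hΔ D).1 hD) hx hy hxy
    hsafe
  obtain ⟨k, hk, S, hS0, hS, hSk⟩ := ih (m - 5) (by lia) T' _
    (fun E => by rw [Finset.mem_filter, hΔ, hT'])
    (H.mono (Finset.filter_subset (fun E => ¬ (x ∈ E ∧ y ∈ E)) Δ)) (by lia)
  refine ⟨k + 1, by lia, fun i => i.casesOn T S, rfl, fun i hi => ?_, hSk⟩
  cases i with
  | zero => simpa [hS0] using hflip
  | succ i => exact hS i (by lia)

end Triangulation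

theorem mainTheorem2 {V : Type*} [Fintype V] [DecidableEq V] (hn : 6 ≤ Fintype.card V)
    (T : Triangulation V) :
    ∃ k : ℕ, k ≤ (3 * Fintype.card V - 6) / 5 ∧
      ∃ S : ℕ → Triangulation V, S 0 = T ∧ (∀ i < k, (S i).IsFlip (S (i + 1))) ∧
        (S k).graph.IsKVertexConnected 4 ∧
        ∀ D : Finset V, ¬ (S k).graph.IsSeparatingTriangle D := by
  classical
  have : Nontrivial V := Fintype.one_lt_card_iff_nontrivial.1 (by lia)
  obtain ⟨x, y, hxy⟩ : ∃ x y, T.graph.Adj x y :=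
    ⟨Classical.arbitrary V, T.connected.preconnected.exists_adj_of_nontrivial _⟩
  -- The root triangle is a face, hence not separating.
  have ho : T.graph.IsNClique 3 {x, y, T.rot y x} :=
    SimpleGraph.is3Clique_triple_iff.2 ⟨hxy, T.adj_rot_right hxy.symm, T.adj_rot hxy.symm⟩
  have hoc : ¬ T.graph.IsSeparatingTriangle {x, y, T.rot y x} := fun h =>
    (T.isSeparatingTriangle_iff.1 h).2 (T.connectedOff_face hxy)
  have hΔ : ∀ D, D ∈ (Finset.univ.filter T.graph.IsSeparatingTriangle : Finset (Finset V)) ↔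
      T.graph.IsSeparatingTriangle D := by simp
  obtain ⟨k, hk, S, hS0, hS, hSk⟩ := Triangulation.exists_isFlip_sequence
    (by rwa [Nat.card_eq_fintype_card]) _ T _ hΔ
    (Triangulation.isNesting ho hoc fun D => (hΔ D).1)
    (Triangulation.nestingPotential_le ho hoc fun D => (hΔ D).1)
  have hcard := T.card_edgeSet_add_six
  rw [Nat.card_eq_fintype_card (α := V)] at hcard
  exact ⟨k, by lia, S, hS0, hS, (S k).isKVertexConnected_four (by lia) hSk, hSk⟩
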